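/- Notation. Let $s\in\mathbb N_0$, let $\mathbb K=\mathbb R$ or $\mathbb C$, and let $\mathcal D(\mathbb R^s)$ be the space of smooth compactly supported functions $\mathbb R^s\to\mathbb K$ with its usual (LF) topology. Put $\mathcal A_0(\mathbb R^s)=\{\varphi\in\mathcal D(\mathbb R^s):\int\varphi=1\}$ and $(S_\varepsilon\varphi)(y)=\varepsilon^{-s}\varphi(y/\varepsilon)$. For an open set $\Omega\subseteq\mathbb R^s$ and $\varepsilon\in(0,1]$ put $$U_\varepsilon(\Omega)=\{(\varphi,x)\in\mathcal A_0(\mathbb R^s)\times\Omega:\ \operatorname{supp}(S_\varepsilon\varphi)\subseteq\Omega-x\}.$$ Let $\mathcal C^\infty_b((0,1]\times\Omega,\mathcal A_0(\mathbb R^s))$ be the set of all smooth maps $\phi:(0,1]\times\Omega\to\mathcal A_0(\mathbb R^s)\subseteq\mathcal D(\mathbb R^s)$ such that for every compact $K\subseteq\Omega$ and every $\beta\in\mathbb N_0^s$ the set $\{\partial_x^\beta\phi(\varepsilon,x):0<\varepsilon\le1,\ x\in K\}$ is bounded in $\mathcal D(\mathbb R^s)$. (Smooth means that all iterated directional derivatives,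 one-sided at $\varepsilon=1$ where necessary, exist as limits of difference quotients in $\mathcal D(\mathbb R^s)$ and are continuous.) **Theorem.** Let $\tilde\Omega,\Omega\subseteq\mathbb R^s$ be open, let $\mu:\tilde\Omega\to\Omega$ be a ($C^\infty$) diffeomorphism, and let $\tilde\phi\in\mathcal C^\infty_b((0,1]\times\tilde\Omega,\mathcal A_0(\mathbb R^s))$. Define $$D=\{(\varepsilon,x)\in(0,1]\times\Omega:\ (\tilde\phi(\varepsilon,\mu^{-1}x),\mu^{-1}x)\in U_\varepsilon(\tilde\Omega)\},$$ and for $(\varepsilon,x)\in D$ let $$\phi(\varepsilon,x)(\xi)=\tilde\phi(\varepsilon,\mu^{-1}x)\left(\frac{\mu^{-1}(\varepsilon\xi+x)-\mu^{-1}x}{\varepsilon}\right)\cdot|\det D\mu^{-1}(\varepsilon\xi+x)|\quad\text{if }\varepsilon\xi+x\in\Omega,$$ and $\phi(\varepsilon,x)(\xi)=0$ if $\varepsilon\xi+x\notin\Omega$. Then $\phi(\varepsilon,x)\in\mathcal A_0(\mathbb R^s)$ for all $(\varepsilon,x)\in D$, and for every compact $L\subseteq\Omega$ there exist $\varepsilon_0\in(0,1]$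 and a set $U\subseteq D$ which is open in $(0,1]\times\Omega$ such that 1. $(0,\varepsilon_0]\times L\subseteq U$, and $\phi$ is smooth on $U$ as a map into $\mathcal D(\mathbb R^s)$; 2. for every $\beta\in\mathbb N_0^s$ the set $\{\partial_x^\beta\phi(\varepsilon,x):0<\varepsilon\le\varepsilon_0,\ x\in L\}$ is bounded in $\mathcal D(\mathbb R^s)$. -/

import Mathlib

open Set Filter Topology MeasureTheory
open scoped ContDiff

/-- Euclidean space `ℝ^s`. -/
abbrev Euc (s : ℕ) : Type := EuclideanSpace ℝ (Fin s)

/-- The space `𝓓(ℝ^s)` of smooth compactly supported `𝕜`-valued functions on `ℝ^s`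
(`𝕜 = ℝ` or `ℂ`), with Mathlib's LF topology. -/
abbrev TestFn (s : ℕ) (𝕜 : Type*) [RCLike 𝕜] : Type _ :=
  TestFunction (⊤ : TopologicalSpace.Opens (Euc s)) 𝕜 (⊤ : ℕ∞)

/-- `𝓐₀(ℝ^s)`: the test functions with integral one. -/
def A0 (s : ℕ) (𝕜 : Type*) [RCLike 𝕜] : Set (TestFn s 𝕜) :=
  {φ | ∫ x, φ x = 1}

/-! ### Smooth maps into a locally convex space -/

section Smooth

/-- `f` has directional derivative `g` at `p` in direction `v`, as the limit of difference
quotients along the line `t ↦ p + t v` inside `U` (one-sided where `U` is). -/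
def HasDirDeriv {P F : Type*} [AddCommGroup P] [Module ℝ P]
    [AddCommGroup F] [Module ℝ F] [TopologicalSpace F]
    (f : P → F) (U : Set P) (v p : P) (g : F) : Prop :=
  Tendsto (fun t : ℝ => t⁻¹ • (f (p + t • v) - f p))
    (𝓝[{t : ℝ | t ≠ 0 ∧ p + t • v ∈ U}] 0) (𝓝 g)

/-- `d` is the family of all iterated directional derivatives of `f` on `U`:
`d [v₁, …, vₖ] = ∂_{v₁} ⋯ ∂_{vₖ} f` on `U`, and each of them is continuous on `U`.
On a set `U` which is open in `(0,1] × Ω` the values of `d` on `U` are uniquely determined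
by `f`. The existence of `d` says that `f` is `C^∞` on `U`, for maps from a (relatively open
subset of a half space of a) finite-dimensional space into a locally convex space. -/
structure IsDerivFamily {P F : Type*} [AddCommGroup P] [Module ℝ P] [TopologicalSpace P]
    [AddCommGroup F] [Module ℝ F] [TopologicalSpace F]
    (f : P → F) (U : Set P) (d : List P → P → F) : Prop where
  nil : EqOn (d []) f U
  cons : ∀ (v : P) (l : List P), ∀ p ∈ U, HasDirDeriv (d l) U v p (d (v :: l) p)
  cont : ∀ l : List P, ContinuousOn (d l) U

end Smooth

/-- The list of directions of the partial derivative `∂^β` in the `x`-variables of `ℝ × ℝ^s`,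
the multi-index `β` being given as the sequence of coordinates to differentiate in. -/
noncomputable def xDirs {s : ℕ} (β : List (Fin s)) : List (ℝ × Euc s) :=
  β.map fun i => (0, EuclideanSpace.single i 1)

/-! ### Test objects -/

/-- `φ ∈ C_b^∞((0,1] × Ω, 𝓐₀(ℝ^s))`: `φ` is smooth on `(0,1] × Ω` with values in `𝓐₀(ℝ^s)`, and
for every compact `K ⊆ Ω` and every `β` the set `{∂^β φ(ε,x) | 0 < ε ≤ 1, x ∈ K}` is
bounded in `𝓓(ℝ^s)`. Only the values of `φ` on `(0,1] × Ω` matter. -/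
structure IsSmoothBoundedPath {s : ℕ} {𝕜 : Type*} [RCLike 𝕜] (Ω : Set (Euc s))
    (φ : ℝ × Euc s → TestFn s 𝕜) : Prop where
  mapsTo : MapsTo φ (Ioc 0 1 ×ˢ Ω) (A0 s 𝕜)
  smooth_bounded : ∃ d : List (ℝ × Euc s) → ℝ × Euc s → TestFn s 𝕜,
    IsDerivFamily φ (Ioc 0 1 ×ˢ Ω) d ∧
    ∀ K : Set (Euc s), IsCompact K → K ⊆ Ω → ∀ β : List (Fin s),
      Bornology.IsVonNBounded ℝ (d (xDirs β) '' (Ioc 0 1 ×ˢ K))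

/-- The requirements on a test object `φ : D → 𝓐₀(ℝ^s)`, `D ⊆ (0,1] × Ω`, in condition (Z).
Only the values of `φ` on `D` matter. -/
structure IsZTestObject {s : ℕ} {𝕜 : Type*} [RCLike 𝕜] (Ω : Set (Euc s))
    (D : Set (ℝ × Euc s)) (φ : ℝ × Euc s → TestFn s 𝕜) : Prop where
  subset : D ⊆ Ioc 0 1 ×ˢ Ω
  mapsTo : MapsTo φ D (A0 s 𝕜)
  smooth_bounded : ∀ L : Set (Euc s), IsCompact L → L ⊆ Ω →
    ∃ ε₀ ∈ Ioc (0 : ℝ) 1, ∃ U : Set (ℝ × Euc s),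
      (∃ V : Set (ℝ × Euc s), IsOpen V ∧ U = V ∩ (Ioc 0 1 ×ˢ Ω)) ∧
      Ioc 0 ε₀ ×ˢ L ⊆ U ∧ U ⊆ D ∧
      ∃ d : List (ℝ × Euc s) → ℝ × Euc s → TestFn s 𝕜,
        IsDerivFamily φ U d ∧
        ∀ β : List (Fin s), Bornology.IsVonNBounded ℝ (d (xDirs β) '' (Ioc 0 ε₀ ×ˢ L))

/-- The scaling `(S_ε φ)(y) = ε^{-s} φ(y / ε)`. -/
noncomputable def scaling {s : ℕ} {𝕜 : Type*} [RCLike 𝕜] (ε : ℝ) (φ : Euc s → 𝕜) :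
    Euc s → 𝕜 :=
  fun y => ((1 / ε) ^ s) • φ ((1 / ε) • y)

/-- `U_ε(Ω)`: the pairs `(φ, x)` in `𝓐₀(ℝ^s) × Ω` with `supp (S_ε φ) ⊆ Ω - x`, that is, with
`(S_ε φ, x) ∈ U(Ω)`. -/
def UEps {s : ℕ} (𝕜 : Type*) [RCLike 𝕜] (ε : ℝ) (Ω : Set (Euc s)) :
    Set (TestFn s 𝕜 × Euc s) :=
  {q | q.1 ∈ A0 s 𝕜 ∧ q.2 ∈ Ω ∧ tsupport (scaling ε q.1) ⊆ {y | y + q.2 ∈ Ω}}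

/-- The set `D` on which the transformed test object is defined. -/
def transDomain {s : ℕ} {𝕜 : Type*} [RCLike 𝕜] (μ : OpenPartialHomeomorph (Euc s) (Euc s))
    (φt : ℝ × Euc s → TestFn s 𝕜) : Set (ℝ × Euc s) :=
  {p | p ∈ Ioc (0 : ℝ) 1 ×ˢ μ.target ∧
    (φt (p.1, μ.symm p.2), μ.symm p.2) ∈ UEps 𝕜 p.1 μ.source}

open Classical in
/-- The function `ξ ↦ φ̃(ε, μ⁻¹x)((μ⁻¹(εξ + x) - μ⁻¹x) / ε) · |det Dμ⁻¹(εξ + x)|`, which is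
given by this formula where `εξ + x` is in the domain `μ.target` of `μ⁻¹`, and is
extended by zero to all of `ℝ^s`. -/
noncomputable def transFun {s : ℕ} {𝕜 : Type*} [RCLike 𝕜]
    (μ : OpenPartialHomeomorph (Euc s) (Euc s)) (φt : ℝ × Euc s → TestFn s 𝕜)
    (ε : ℝ) (x ξ : Euc s) : 𝕜 :=
  if ε • ξ + x ∈ μ.target then
    |(fderiv ℝ μ.symm (ε • ξ + x)).det| •
      φt (ε, μ.symm x) (ε⁻¹ • (μ.symm (ε • ξ + x) - μ.symm x))
  else 0

/-!
The transformed test object is treated as a scalar function of all variables,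
`(ε, x, ξ) ↦ transFun μ φt ε x ξ`, and smoothness and boundedness are shown there.

*Passing between the two pictures.* A smooth map into the space of test functions, evaluated at a
point, has continuous directional derivatives of all orders in the parameter and in the variable;
so it is jointly smooth (`IsDerivFamily.contDiffOn_eval`), because a family of continuous functions
closed under directional derivatives along a basis consists of smooth functions
(`contDiffOn_of_basis_family`). If the values of the map form a bounded set, then the functions are
supported in a common ball (`exists_forall_eq_zero_of_isVonNBounded`) and their directional
derivatives are bounded. Conversely, a jointly smooth function with support in a fixed compact set
in the second variable is a smooth map into test functions
(`isDerivFamily_sliceSupportedIn`).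

*Uniform bounds.* With `ν = μ⁻¹`, the transformed function is the product of
`|det Dν (ε ξ + x)|` and of `φt (ε, ν x)` evaluated at the difference quotient
`ε⁻¹ (ν (ε ξ + x) - ν x)`. All derivatives of that quotient in `(x, ξ)` are bounded uniformly in
`ε`, although `ε⁻¹` is not: its derivative is the difference quotient of `Dν` plus a bounded term
(`SmoothBdd.diffQuot`). As families with uniformly bounded derivatives are stable under products
and compositions (`SmoothBdd`), the transformed functions form such a family
(`smoothBdd_transFun`).

*Supports.* If `φt (ε, ν x)` is supported in the ball of radius `R` for all `ε` and for `x` in a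
compact set, and `C` bounds the derivative of `μ` near the image of that set under `ν`, then for
small `ε` the transformed function is supported in the ball of radius `C R`
(`exists_transFun_support_bound`). Membership in `𝓐₀` is the change of variables formula
(`integral_transFun`). For a compact `L` the set `U` is a product `(0, ε₁) × V` with `V` a relatively
compact neighbourhood of `L`. It is open in `ℝ × ℝ^s`, so that one-sided derivatives play no role.
-/

/-! ### Smoothness and bounds from directional derivatives along a basis -/

section Basis

variable {κ ι X F : Type*} [Fintype κ] [NormedAddCommGroup X] [NormedSpace ℝ X]
  [NormedAddCommGroup F] [NormedSpace ℝ F]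

/-- The linear map with value `w k` at the `k`-th vector of the basis `b`. -/
noncomputable def basisCLM (b : Module.Basis κ ℝ X) (w : κ → F) : X →L[ℝ] F :=
  haveI := Module.Finite.of_basis b
  ∑ k, (b.coord k).toContinuousLinearMap.smulRight (w k)

theorem basisCLM_apply (b : Module.Basis κ ℝ X) (w : κ → F) (h : X) :
    basisCLM b w h = ∑ k, b.coord k h • w k := by
  simp [basisCLM]

/-- The mean value inequality along a line, compared with a constant derivative `w`. -/
theorem norm_line_increment_sub_le {g g' : X → F} {y v : X} {τ ε : ℝ} {w : F}
    (hd : ∀ t ∈ uIcc 0 τ, HasLineDerivAt ℝ g (g' (y + t • v)) (y + t • v) v)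
    (hb : ∀ t ∈ uIcc 0 τ, ‖g' (y + t • v) - w‖ ≤ ε) :
    ‖g (y + τ • v) - g y - τ • w‖ ≤ ε * |τ| := by
  have key := Convex.norm_image_sub_le_of_norm_hasDerivWithin_le (𝕜 := ℝ)
    (f := fun t => g (y + t • v) - t • w) (f' := fun t => g' (y + t • v) - w)
    (s := uIcc 0 τ) (x := 0) (y := τ) (C := ε) ?_ hb (convex_uIcc 0 τ) left_mem_uIcc right_mem_uIcc
  · simpa [sub_right_comm] using key
  · intro t ht
    have h1 : HasDerivAt (fun r : ℝ => g (y + r • v)) (g' (y + t • v)) t := by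
      have h0 := hd t ht
      rw [HasLineDerivAt] at h0
      have h2 := HasDerivAt.comp_sub_const t t (f := fun r : ℝ => g (y + t • v + r • v))
        (by simpa using h0)
      refine h2.congr_of_eventuallyEq (Eventually.of_forall fun r => ?_)
      simp [sub_smul, add_assoc]
    have h3 : HasDerivAt (fun r : ℝ => r • w) w t := by
      simpa using (hasDerivAt_id t).smul_const w
    exact (h1.sub h3).hasDerivWithinAt

/-- The increment of `g` when the coordinates in `s` are moved one after the other. -/
theorem norm_partial_increment_le (b : Module.Basis κ ℝ X) {g : X → F} {g' : κ → X → F} {x : X}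
    {ε r : ℝ} (hd : ∀ k, ∀ y ∈ Metric.ball x r, HasLineDerivAt ℝ g (g' k y) y (b k))
    (hb : ∀ k, ∀ y ∈ Metric.ball x r, ‖g' k y - g' k x‖ ≤ ε) (h : X)
    (hh : ∑ k, ‖b.coord k h • b k‖ < r) (s : Finset κ) :
    ‖g (x + ∑ k ∈ s, b.coord k h • b k) - g x - ∑ k ∈ s, b.coord k h • g' k x‖
      ≤ ε * ∑ k ∈ s, |b.coord k h| := by
  classical
  induction s using Finset.induction_on with
  | empty => simp
  | insert k s hk ih =>
    rw [Finset.sum_insert hk, Finset.sum_insert hk, Finset.sum_insert hk]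
    set y := x + ∑ j ∈ s, b.coord j h • b j with hy
    have mem : ∀ t ∈ uIcc 0 (b.coord k h), y + t • b k ∈ Metric.ball x r := by
      intro t ht
      have ht' : |t| ≤ |b.coord k h| := by
        rcases le_total 0 (b.coord k h) with h0 | h0
        · rw [uIcc_of_le h0] at ht
          rw [abs_of_nonneg ht.1, abs_of_nonneg h0]; exact ht.2
        · rw [uIcc_of_ge h0] at ht
          rw [abs_of_nonpos ht.2, abs_of_nonpos h0]; linarith [ht.1]
      rw [mem_ball_iff_norm, hy]
      calc ‖x + ∑ j ∈ s, b.coord j h • b j + t • b k - x‖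
          = ‖t • b k + ∑ j ∈ s, b.coord j h • b j‖ := by congr 1; abel
        _ ≤ ‖t • b k‖ + ∑ j ∈ s, ‖b.coord j h • b j‖ :=
            (norm_add_le _ _).trans (by gcongr; exact norm_sum_le _ _)
        _ ≤ ‖b.coord k h • b k‖ + ∑ j ∈ s, ‖b.coord j h • b j‖ := by
            rw [norm_smul, norm_smul]; gcongr; simpa using ht'
        _ = ∑ j ∈ insert k s, ‖b.coord j h • b j‖ := by rw [Finset.sum_insert hk]
        _ ≤ ∑ j, ‖b.coord j h • b j‖ :=
            Finset.sum_le_univ_sum_of_nonneg fun _ => norm_nonneg _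
        _ < r := hh
    have step := norm_line_increment_sub_le (g := g) (g' := g' k) (w := g' k x) (ε := ε)
      (fun t ht => hd k _ (mem t ht)) (fun t ht => hb k _ (mem t ht))
    have e : x + (b.coord k h • b k + ∑ j ∈ s, b.coord j h • b j) = y + b.coord k h • b k := by
      rw [hy]; abel
    rw [e]
    calc _ = ‖(g (y + b.coord k h • b k) - g y - b.coord k h • g' k x)
              + (g y - g x - ∑ j ∈ s, b.coord j h • g' j x)‖ := by congr 1; abel
      _ ≤ _ := (norm_add_le _ _).trans (by rw [mul_add]; exact add_le_add step ih)

/-- A function with continuous directional derivatives along the vectors of a basis is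
differentiable. -/
theorem hasFDerivAt_of_basis (b : Module.Basis κ ℝ X) {W : Set X} (hW : IsOpen W) {g : X → F}
    {g' : κ → X → F} (hd : ∀ k, ∀ y ∈ W, HasLineDerivAt ℝ g (g' k y) y (b k))
    (hc : ∀ k, ContinuousOn (g' k) W) {x : X} (hx : x ∈ W) :
    HasFDerivAt g (basisCLM b fun k => g' k x) x := by
  have := Module.Finite.of_basis b
  let c : κ → X →L[ℝ] ℝ := fun k => (b.coord k).toContinuousLinearMap
  have hcb : ∀ k h, |b.coord k h| ≤ ‖c k‖ * ‖h‖ := fun k h => (c k).le_opNorm h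
  rw [hasFDerivAt_iff_isLittleO_nhds_zero, Asymptotics.isLittleO_iff]
  intro ε hε
  set M : ℝ := ∑ k, ‖c k‖ + 1 with hM
  have hM0 : 0 < M := by positivity
  set ε' := ε / M with hε'
  have hε0 : 0 < ε' := by positivity
  have hnear : ∀ᶠ y in 𝓝 x, y ∈ W ∧ ∀ k, ‖g' k y - g' k x‖ ≤ ε' := by
    refine Filter.Eventually.and (hW.mem_nhds hx) (eventually_all.2 fun k => ?_)
    have := ((hc k).continuousAt (hW.mem_nhds hx)).tendsto
    filter_upwards [Metric.tendsto_nhds.1 this ε' hε0] with y hy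
    rw [← dist_eq_norm]; exact hy.le
  obtain ⟨r, hr, hball⟩ := Metric.eventually_nhds_iff_ball.1 hnear
  have hsmall : ∀ᶠ h in 𝓝 (0 : X), ∑ k, ‖b.coord k h • b k‖ < r := by
    have : Continuous fun h => ∑ k, ‖b.coord k h • b k‖ :=
      continuous_finsetSum _ fun k _ => ((c k).continuous.smul continuous_const).norm
    have h0 := this.tendsto 0
    simp only [map_zero, zero_smul, norm_zero, Finset.sum_const_zero] at h0
    exact h0.eventually (gt_mem_nhds hr)
  filter_upwards [hsmall] with h hh
  have key := norm_partial_increment_le b (fun k y hy => hd k y (hball y hy).1)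
    (fun k y hy => (hball y hy).2 k) h hh Finset.univ
  have hrep : ∑ k, b.coord k h • b k = h := b.sum_repr h
  rw [hrep] at key
  rw [basisCLM_apply]
  refine key.trans ?_
  calc ε' * ∑ k, |b.coord k h| ≤ ε' * ∑ k, ‖c k‖ * ‖h‖ := by
        gcongr with k; exact hcb k h
    _ ≤ ε' * (M * ‖h‖) := by
        rw [← Finset.sum_mul]; gcongr; rw [hM]; linarith
    _ = ε * ‖h‖ := by rw [hε']; field_simp

/-- A family of continuous functions which is closed under directional derivatives along the
vectors of a basis consists of smooth functions. -/
theorem contDiffOn_of_basis_family (b : Module.Basis κ ℝ X) {W : Set X} (hW : IsOpen W)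
    (g : ι → X → F) (next : κ → ι → ι)
    (hd : ∀ k j, ∀ x ∈ W, HasLineDerivAt ℝ (g j) (g (next k j) x) x (b k))
    (hc : ∀ j, ContinuousOn (g j) W) (j : ι) : ContDiffOn ℝ ∞ (g j) W := by
  have := Module.Finite.of_basis b
  rw [contDiffOn_infty]
  intro n
  have hf : ∀ j, ∀ x ∈ W, HasFDerivAt (g j) (basisCLM b fun k => g (next k j) x) x :=
    fun j x hx => hasFDerivAt_of_basis b hW (fun k => hd k j) (fun k => hc _) hx
  induction n generalizing j with
  | zero => exact contDiffOn_zero.2 (hc j)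
  | succ n ih =>
    push_cast
    rw [contDiffOn_succ_iff_fderiv_of_isOpen hW]
    refine ⟨fun x hx => (hf j x hx).differentiableAt.differentiableWithinAt, by simp, ?_⟩
    have : EqOn (fderiv ℝ (g j)) (fun x => basisCLM b fun k => g (next k j) x) W :=
      fun x hx => (hf j x hx).fderiv
    refine ContDiffOn.congr ?_ this
    unfold basisCLM
    exact ContDiffOn.sum fun k _ => contDiffOn_const.smulRight (ih _)

end Basis

/-! ### Families with uniformly bounded derivatives -/

/-- The family `g a`, `a : A`, is smooth at the points of `S ⊆ A × X`, and each of its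
iterated derivatives in the variable of `X` is bounded on `S`, uniformly in the parameter. -/
structure SmoothBdd {A X F : Type*} [NormedAddCommGroup X] [NormedSpace ℝ X]
    [NormedAddCommGroup F] [NormedSpace ℝ F] (g : A → X → F) (S : Set (A × X)) : Prop where
  contDiffAt : ∀ q ∈ S, ContDiffAt ℝ ∞ (g q.1) q.2
  bdd : ∀ i : ℕ, ∃ C, ∀ q ∈ S, ‖iteratedFDeriv ℝ i (g q.1) q.2‖ ≤ C

section SmoothBddCalculus

variable {A A' κ ι X Y F G : Type*} [NormedAddCommGroup X] [NormedSpace ℝ X]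
  [NormedAddCommGroup Y] [NormedSpace ℝ Y] [NormedAddCommGroup F] [NormedSpace ℝ F]
  [NormedAddCommGroup G] [NormedSpace ℝ G]

theorem ContDiffAt.exists_isOpen_contDiffOn {f : X → F} {x : X} {n : ℕ}
    (hf : ContDiffAt ℝ n f x) {V : Set X} (hV : V ∈ 𝓝 x) :
    ∃ u ⊆ V, IsOpen u ∧ x ∈ u ∧ ContDiffOn ℝ n f u := by
  obtain ⟨u, hu, hfu⟩ := hf.contDiffOn le_rfl (by simp)
  obtain ⟨w, hw, hwo, hxw⟩ := mem_nhds_iff.1 (inter_mem hu hV)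
  exact ⟨w, hw.trans inter_subset_right, hwo, hxw, hfu.mono (hw.trans inter_subset_left)⟩

theorem norm_iteratedFDeriv_comp_le_of_contDiffAt {g : Y → F} {f : X → Y} {x : X} {n : ℕ}
    (hg : ContDiffAt ℝ n g (f x)) (hf : ContDiffAt ℝ n f x) {C D : ℝ}
    (hC : ∀ i ≤ n, ‖iteratedFDeriv ℝ i g (f x)‖ ≤ C)
    (hD : ∀ i, 1 ≤ i → i ≤ n → ‖iteratedFDeriv ℝ i f x‖ ≤ D ^ i) :
    ‖iteratedFDeriv ℝ n (fun y => g (f y)) x‖ ≤ n.factorial * C * D ^ n := by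
  obtain ⟨t, -, hto, hxt, hgt⟩ := hg.exists_isOpen_contDiffOn univ_mem
  obtain ⟨s, hst, hso, hxs, hfs⟩ := hf.exists_isOpen_contDiffOn
    (hf.continuousAt.preimage_mem_nhds (hto.mem_nhds hxt))
  have := norm_iteratedFDerivWithin_comp_le hgt hfs le_rfl hto.uniqueDiffOn hso.uniqueDiffOn hst
    hxs (C := C) (D := D)
    (fun i hi => by rw [iteratedFDerivWithin_of_isOpen i hto hxt]; exact hC i hi)
    (fun i h1 hi => by rw [iteratedFDerivWithin_of_isOpen i hso hxs]; exact hD i h1 hi)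
  rwa [iteratedFDerivWithin_of_isOpen n hso hxs] at this

theorem norm_iteratedFDeriv_smul_le_of_contDiffAt {f : X → ℝ} {g : X → F} {x : X} {n : ℕ}
    (hf : ContDiffAt ℝ n f x) (hg : ContDiffAt ℝ n g x) :
    ‖iteratedFDeriv ℝ n (fun y => f y • g y) x‖ ≤ ∑ i ∈ Finset.range (n + 1),
      (n.choose i) * ‖iteratedFDeriv ℝ i f x‖ * ‖iteratedFDeriv ℝ (n - i) g x‖ := by
  obtain ⟨t, -, hto, hxt, hgt⟩ := hg.exists_isOpen_contDiffOn univ_mem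
  obtain ⟨s, hst, hso, hxs, hfs⟩ := hf.exists_isOpen_contDiffOn (hto.mem_nhds hxt)
  have := norm_iteratedFDerivWithin_smul_le hfs (hgt.mono hst) hso.uniqueDiffOn hxs
    (n := n) le_rfl
  simpa only [iteratedFDerivWithin_of_isOpen _ hso hxs] using this

namespace SmoothBdd

variable {S : Set (A × X)}

theorem contDiffAt_nat {g : A → X → F} (hg : SmoothBdd g S) {q : A × X} (hq : q ∈ S) (n : ℕ) :
    ContDiffAt ℝ n (g q.1) q.2 :=
  (hg.contDiffAt q hq).of_le (mod_cast le_top)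

theorem exists_bound {g : A → X → F} (hg : SmoothBdd g S) (n : ℕ) :
    ∃ C, 1 ≤ C ∧ ∀ i ≤ n, ∀ q ∈ S, ‖iteratedFDeriv ℝ i (g q.1) q.2‖ ≤ C := by
  choose c hc using hg.bdd
  refine ⟨1 + ∑ i ∈ Finset.range (n + 1), |c i|, by
    have : 0 ≤ ∑ i ∈ Finset.range (n + 1), |c i| := Finset.sum_nonneg fun _ _ => abs_nonneg _
    linarith, fun i hi q hq => ?_⟩
  have h1 : |c i| ≤ ∑ i ∈ Finset.range (n + 1), |c i| :=
    Finset.single_le_sum (f := fun i => |c i|) (fun _ _ => abs_nonneg _)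
      (Finset.mem_range.2 (by omega))
  linarith [hc i q hq, le_abs_self (c i)]

/-- Changing the parameter, shrinking the set and passing to germs. -/
theorem reindex {g : A → X → F} (hg : SmoothBdd g S) {σ : A' → A} {f : A' → X → F}
    {S' : Set (A' × X)} (hS : ∀ q ∈ S', (σ q.1, q.2) ∈ S)
    (hf : ∀ q ∈ S', f q.1 =ᶠ[𝓝 q.2] g (σ q.1)) : SmoothBdd f S' where
  contDiffAt q hq := (hg.contDiffAt _ (hS q hq)).congr_of_eventuallyEq (hf q hq)
  bdd i := by
    obtain ⟨C, hC⟩ := hg.bdd i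
    refine ⟨C, fun q hq => ?_⟩
    rw [((hf q hq).iteratedFDeriv ℝ i).eq_of_nhds]
    exact hC _ (hS q hq)

theorem comp {g : A → Y → F} {T : Set (A × Y)} (hg : SmoothBdd g T) {f : A → X → Y}
    (hf : SmoothBdd f S) (h : ∀ q ∈ S, (q.1, f q.1 q.2) ∈ T) :
    SmoothBdd (fun a x => g a (f a x)) S where
  contDiffAt q hq := (hg.contDiffAt _ (h q hq)).comp q.2 (hf.contDiffAt q hq)
  bdd n := by
    obtain ⟨C, -, hC⟩ := hg.exists_bound n
    obtain ⟨D, hD1, hD⟩ := hf.exists_bound n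
    -- The bound for compositions needs `‖D^i f‖ ≤ D ^ i`; this follows from `‖D^i f‖ ≤ D` and
    -- `1 ≤ D`.
    refine ⟨n.factorial * C * D ^ n, fun q hq => ?_⟩
    refine norm_iteratedFDeriv_comp_le_of_contDiffAt (g := g q.1) (f := f q.1)
      (hg.contDiffAt_nat (h q hq) n)
      (hf.contDiffAt_nat hq n) (fun i hi => hC i hi _ (h q hq)) fun i h1 hi => ?_
    exact (hD i hi q hq).trans (le_self_pow₀ hD1 (by omega))

theorem smul {f : A → X → ℝ} {g : A → X → F} (hf : SmoothBdd f S) (hg : SmoothBdd g S) :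
    SmoothBdd (fun a x => f a x • g a x) S where
  contDiffAt q hq := (hf.contDiffAt q hq).smul (hg.contDiffAt q hq)
  bdd n := by
    obtain ⟨C, hC1, hC⟩ := hf.exists_bound n
    obtain ⟨D, -, hD⟩ := hg.exists_bound n
    refine ⟨∑ i ∈ Finset.range (n + 1), (n.choose i) * C * D, fun q hq => ?_⟩
    refine (norm_iteratedFDeriv_smul_le_of_contDiffAt (hf.contDiffAt_nat hq n)
      (hg.contDiffAt_nat hq n)).trans (Finset.sum_le_sum fun i hi => ?_)
    have hi' : i ≤ n := by have := Finset.mem_range.1 hi; omega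
    gcongr
    · exact hC i hi' q hq
    · exact hD _ (by omega) q hq

theorem clm_comp {f : A → X → F} (hf : SmoothBdd f S) (L : F →L[ℝ] G) :
    SmoothBdd (fun a x => L (f a x)) S where
  contDiffAt q hq := L.contDiff.contDiffAt.comp q.2 (hf.contDiffAt q hq)
  bdd n := by
    obtain ⟨C, hC⟩ := hf.bdd n
    refine ⟨‖L‖ * C, fun q hq => ?_⟩
    refine (L.norm_iteratedFDeriv_comp_left (hf.contDiffAt_nat hq n) le_rfl).trans ?_
    gcongr
    exact hC q hq

theorem add {f g : A → X → F} (hf : SmoothBdd f S) (hg : SmoothBdd g S) :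
    SmoothBdd (fun a x => f a x + g a x) S where
  contDiffAt q hq := (hf.contDiffAt q hq).add (hg.contDiffAt q hq)
  bdd n := by
    obtain ⟨C, hC⟩ := hf.bdd n
    obtain ⟨D, hD⟩ := hg.bdd n
    refine ⟨C + D, fun q hq => ?_⟩
    have := iteratedFDeriv_add_apply (hf.contDiffAt_nat hq n) (hg.contDiffAt_nat hq n)
    change ‖iteratedFDeriv ℝ n (f q.1 + g q.1) q.2‖ ≤ _
    rw [this]
    exact (norm_add_le _ _).trans (add_le_add (hC q hq) (hD q hq))

theorem prodMk {f : A → X → F} {g : A → X → G} (hf : SmoothBdd f S) (hg : SmoothBdd g S) :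
    SmoothBdd (fun a x => (f a x, g a x)) S := by
  simpa using (hf.clm_comp (.inl ℝ F G)).add (hg.clm_comp (.inr ℝ F G))

theorem const {c : A → F} {C : ℝ} (hc : ∀ q ∈ S, ‖c q.1‖ ≤ C) :
    SmoothBdd (fun a (_ : X) => c a) S where
  contDiffAt q _ := contDiffAt_const
  bdd n := by
    rcases Nat.eq_zero_or_pos n with rfl | hn
    · exact ⟨C, fun q hq => by simpa using hc q hq⟩
    · exact ⟨0, fun q _ => by simp [iteratedFDeriv_const_of_ne hn.ne']⟩

theorem of_isCompact {w : X → F} {W K : Set X} (hW : IsOpen W) (hw : ContDiffOn ℝ ∞ w W)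
    (hK : IsCompact K) (hKW : K ⊆ W) (hS : ∀ q ∈ S, q.2 ∈ K) :
    SmoothBdd (fun _ : A => w) S where
  contDiffAt q hq := hw.contDiffAt (hW.mem_nhds (hKW (hS q hq)))
  bdd n := by
    have : ContinuousOn (iteratedFDeriv ℝ n w) K := fun x hx =>
      ((hw.contDiffAt (hW.mem_nhds (hKW hx))).iteratedFDeriv_right (m := 0) (i := n)
        (by simpa using (mod_cast le_top : ((n : ℕ∞) : WithTop ℕ∞) ≤ ∞))).continuousAt
        |>.continuousWithinAt
    obtain ⟨C, hC⟩ := hK.exists_bound_of_continuousOn this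
    exact ⟨C, fun q hq => hC _ (hS q hq)⟩

theorem clm_of_le (L : X →L[ℝ] F) {R : ℝ} (hR : ∀ q ∈ S, ‖q.2‖ ≤ R) :
    SmoothBdd (fun _ : A => (L : X → F)) S where
  contDiffAt q _ := L.contDiff.contDiffAt
  bdd n := by
    match n with
    | 0 =>
      refine ⟨‖L‖ * R, fun q hq => ?_⟩
      rw [norm_iteratedFDeriv_zero]
      exact (L.le_opNorm _).trans (by gcongr; exact hR q hq)
    | 1 =>
      refine ⟨‖L‖, fun q _ => ?_⟩
      rw [norm_iteratedFDeriv_one, L.fderiv]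
    | n + 2 =>
      refine ⟨0, fun q _ => ?_⟩
      rw [← norm_iteratedFDeriv_fderiv]
      have : fderiv ℝ (L : X → F) = fun _ => L := by ext1 x; exact L.fderiv
      rw [this, iteratedFDeriv_const_of_ne (by omega)]
      simp

theorem fderiv_apply {g : A → X → F} (hg : SmoothBdd g S) (v : X) :
    SmoothBdd (fun a x => fderiv ℝ (g a) x v) S := by
  have : SmoothBdd (fun a => fderiv ℝ (g a)) S :=
    { contDiffAt := fun q hq => (hg.contDiffAt q hq).fderiv_right (by simp)
      bdd := fun n => by
        obtain ⟨C, hC⟩ := hg.bdd (n + 1)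
        refine ⟨C, fun q hq => ?_⟩
        rw [norm_iteratedFDeriv_fderiv]
        exact hC q hq }
  exact this.clm_comp (ContinuousLinearMap.apply ℝ F v)

/-- A family of smooth functions which is closed under directional derivatives along the vectors
of a basis, and whose members are bounded, has bounded derivatives of all orders. -/
theorem of_basis_family [Fintype κ] (b : Module.Basis κ ℝ X) (g : ι → A → X → F)
    (next : κ → ι → ι) {W : A → Set X} (hW : ∀ a, IsOpen (W a)) (hSW : ∀ q ∈ S, q.2 ∈ W q.1)
    (hd : ∀ k j a, ∀ x ∈ W a, HasLineDerivAt ℝ (g j a) (g (next k j) a x) x (b k))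
    (hc : ∀ j a, ContinuousOn (g j a) (W a))
    (hbdd : ∀ j, ∃ C, ∀ q ∈ S, ‖g j q.1 q.2‖ ≤ C) (j : ι) : SmoothBdd (g j) S := by
  have hsm : ∀ j, ∀ q ∈ S, ContDiffAt ℝ ∞ (g j q.1) q.2 := fun j q hq =>
    (contDiffOn_of_basis_family b (hW q.1) (fun j => g j q.1) next (fun k j => hd k j q.1)
      (fun j => hc j q.1) j).contDiffAt ((hW q.1).mem_nhds (hSW q hq))
  refine ⟨hsm j, fun n => ?_⟩
  induction n generalizing j with
  | zero => simpa using hbdd j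
  | succ n ih =>
    have := Module.Finite.of_basis b
    let L : κ → F →L[ℝ] X →L[ℝ] F := fun k =>
      ContinuousLinearMap.smulRightL ℝ X F (b.coord k).toContinuousLinearMap
    choose c hcb using fun k => ih (next k j)
    refine ⟨∑ k, ‖L k‖ * c k, fun q hq => ?_⟩
    have hf : fderiv ℝ (g j q.1) =ᶠ[𝓝 q.2] fun x => ∑ k, L k (g (next k j) q.1 x) := by
      filter_upwards [(hW q.1).mem_nhds (hSW q hq)] with x hx
      rw [(hasFDerivAt_of_basis b (hW q.1) (fun k => hd k j q.1) (fun k => hc _ _) hx).fderiv]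
      rfl
    have hn : ∀ k, ContDiffAt ℝ n (fun x => L k (g (next k j) q.1 x)) q.2 := fun k =>
      (L k).contDiff.contDiffAt.comp q.2 ((hsm (next k j) q hq).of_le (mod_cast le_top))
    rw [← norm_iteratedFDeriv_fderiv, (hf.iteratedFDeriv ℝ n).eq_of_nhds,
      iteratedFDeriv_fun_sum_apply fun k _ => hn k]
    refine (norm_sum_le _ _).trans (Finset.sum_le_sum fun k _ => ?_)
    refine ((L k).norm_iteratedFDeriv_comp_left (N := n)
      ((hsm (next k j) q hq).of_le (mod_cast le_top)) le_rfl).trans ?_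
    gcongr
    exact hcb k q hq

end SmoothBdd

end SmoothBddCalculus

/-! ### Difference quotients -/

namespace SmoothBdd

universe u

variable {E F : Type u} [NormedAddCommGroup E] [NormedSpace ℝ E]
  [NormedAddCommGroup F] [NormedSpace ℝ F]

theorem smul_snd_add_fst {S : Set (ℝ × (E × E))} {R : ℝ}
    (hε : ∀ q ∈ S, ‖q.1‖ ≤ 1) (hz : ∀ q ∈ S, ‖q.2‖ ≤ R) :
    SmoothBdd (fun (ε : ℝ) (z : E × E) => ε • z.2 + z.1) S :=
  ((const (c := fun ε : ℝ => ε) hε).smul (clm_of_le (.snd ℝ E E) hz)).add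
    (clm_of_le (.fst ℝ E E) hz)

/-- The difference quotients of a smooth function have derivatives of all orders which are bounded
uniformly in the step size. The derivative of the difference quotient of `ν` is the difference
quotient of `fderiv ℝ ν` plus a bounded term, so that the bounds follow by induction on the order
from the mean value inequality. -/
theorem diffQuot {ν : E → F} {Ω K : Set E} (hΩ : IsOpen Ω) (hν : ContDiffOn ℝ ∞ ν Ω)
    (hK : IsCompact K) (hKΩ : K ⊆ Ω) {R : ℝ} {S : Set (ℝ × (E × E))}
    (hε : ∀ q ∈ S, 0 < q.1 ∧ q.1 ≤ 1) (hR : ∀ q ∈ S, ‖q.2.2‖ ≤ R)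
    (hseg : ∀ q ∈ S, segment ℝ q.2.1 (q.1 • q.2.2 + q.2.1) ⊆ K) :
    SmoothBdd (fun (ε : ℝ) (z : E × E) => ε⁻¹ • (ν (ε • z.2 + z.1) - ν z.1)) S := by
  obtain ⟨M, hM⟩ := hK.isBounded.exists_norm_le
  have hlin : SmoothBdd (fun (ε : ℝ) (z : E × E) => ε • z.2 + z.1) S := by
    refine smul_snd_add_fst (R := max M R) (fun q hq => ?_) fun q hq => ?_
    · rw [Real.norm_of_nonneg (hε q hq).1.le]; exact (hε q hq).2
    · exact max_le_max (hM _ (hseg q hq (left_mem_segment ..))) (hR q hq)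
  have hmem1 : ∀ q ∈ S, q.2.1 ∈ Ω := fun q hq => hKΩ (hseg q hq (left_mem_segment ..))
  have hmem2 : ∀ q ∈ S, q.1 • q.2.2 + q.2.1 ∈ Ω := fun q hq =>
    hKΩ (hseg q hq (right_mem_segment ..))
  have hA : ∀ ε : ℝ, ContDiff ℝ ∞ fun z : E × E => ε • z.2 + z.1 := fun ε =>
    (contDiff_snd.const_smul ε).add contDiff_fst
  have hsmooth : ∀ {G : Type u} [NormedAddCommGroup G] [NormedSpace ℝ G] (g : E → G),
      ContDiffOn ℝ ∞ g Ω → ∀ q ∈ S,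
      ContDiffAt ℝ ∞ (fun z : E × E => q.1⁻¹ • (g (q.1 • z.2 + z.1) - g z.1)) q.2 := by
    intro G _ _ g hg q hq
    exact contDiffAt_const.smul
      (((hg.contDiffAt (hΩ.mem_nhds (hmem2 q hq))).comp q.2 (hA q.1).contDiffAt).sub
      ((hg.contDiffAt (hΩ.mem_nhds (hmem1 q hq))).comp q.2 contDiff_fst.contDiffAt))
  refine ⟨hsmooth ν hν, fun n => ?_⟩
  induction n generalizing F with
  | zero =>
    have : ContinuousOn (fderiv ℝ ν) K := fun x hx =>
      ((hν.contDiffAt (hΩ.mem_nhds (hKΩ hx))).fderiv_right (m := 0)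
        (by simp)).continuousAt.continuousWithinAt
    obtain ⟨C, hC⟩ := hK.exists_bound_of_continuousOn this
    refine ⟨|C| * R, fun q hq => ?_⟩
    have mv := Convex.norm_image_sub_le_of_norm_fderiv_le (𝕜 := ℝ) (f := ν) (C := |C|)
      (s := segment ℝ q.2.1 (q.1 • q.2.2 + q.2.1))
      (fun x hx => (hν.contDiffAt (hΩ.mem_nhds (hKΩ (hseg q hq hx)))).differentiableAt (by simp))
      (fun x hx => (hC x (hseg q hq hx)).trans (le_abs_self C))
      (convex_segment ..) (left_mem_segment ..) (right_mem_segment ..)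
    have h0 := (hε q hq).1
    rw [norm_iteratedFDeriv_zero, norm_smul, norm_inv, Real.norm_of_nonneg h0.le,
      inv_mul_le_iff₀ h0]
    refine mv.trans ?_
    rw [add_sub_cancel_right, norm_smul, Real.norm_of_nonneg h0.le]
    have := hR q hq
    nlinarith [mul_le_mul_of_nonneg_left this (mul_nonneg (abs_nonneg C) h0.le)]
  | succ n ih =>
    have hν' : ContDiffOn ℝ ∞ (fderiv ℝ ν) Ω := hν.fderiv_of_isOpen hΩ (by simp)
    obtain ⟨C, hC⟩ := ih (ν := fderiv ℝ ν) hν'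
    have hcomp : SmoothBdd (fun (ε : ℝ) (z : E × E) => fderiv ℝ ν (ε • z.2 + z.1)) S :=
      (of_isCompact (S := univ ×ˢ K) hΩ hν' hK hKΩ fun q hq => hq.2).comp hlin
        fun q hq => ⟨trivial, hseg q hq (right_mem_segment ..)⟩
    obtain ⟨D, hD⟩ := hcomp.bdd n
    -- `D (diffQuot ν) = (diffQuot Dν) ∘ fst + Dν (ε • z.2 + z.1) ∘ snd`
    let L₁ : (E →L[ℝ] F) →L[ℝ] (E × E →L[ℝ] F) :=
      (ContinuousLinearMap.compL ℝ (E × E) E F).flip (.fst ℝ E E)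
    let L₂ : (E →L[ℝ] F) →L[ℝ] (E × E →L[ℝ] F) :=
      (ContinuousLinearMap.compL ℝ (E × E) E F).flip (.snd ℝ E E)
    refine ⟨‖L₁‖ * C + ‖L₂‖ * D, fun q hq => ?_⟩
    have h0 := (hε q hq).1
    have hf : fderiv ℝ (fun z : E × E => q.1⁻¹ • (ν (q.1 • z.2 + z.1) - ν z.1)) =ᶠ[𝓝 q.2]
        (L₁ ∘ fun z => q.1⁻¹ • (fderiv ℝ ν (q.1 • z.2 + z.1) - fderiv ℝ ν z.1)) +
          L₂ ∘ fun z => fderiv ℝ ν (q.1 • z.2 + z.1) := by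
      filter_upwards [(hA q.1).continuous.continuousAt.preimage_mem_nhds
        (hΩ.mem_nhds (hmem2 q hq)), continuous_fst.continuousAt.preimage_mem_nhds
        (hΩ.mem_nhds (hmem1 q hq))] with z hz2 hz1
      have d1 : HasFDerivAt ν (fderiv ℝ ν z.1) z.1 :=
        ((hν.contDiffAt (hΩ.mem_nhds hz1)).differentiableAt (by simp)).hasFDerivAt
      have d2 : HasFDerivAt ν (fderiv ℝ ν (q.1 • z.2 + z.1)) (q.1 • z.2 + z.1) :=
        ((hν.contDiffAt (hΩ.mem_nhds hz2)).differentiableAt (by simp)).hasFDerivAt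
      have dA : HasFDerivAt (fun z : E × E => q.1 • z.2 + z.1)
          (q.1 • ContinuousLinearMap.snd ℝ E E + ContinuousLinearMap.fst ℝ E E) z :=
        (hasFDerivAt_snd.const_smul q.1).add hasFDerivAt_fst
      have d := ((d2.comp z dA).sub (d1.comp z hasFDerivAt_fst)).const_smul q.1⁻¹
      refine d.fderiv.trans ?_
      ext v <;> simp [L₁, L₂, smul_sub, h0.ne']
    have s1 := (hsmooth (fderiv ℝ ν) hν' q hq).of_le (m := n) (mod_cast le_top)
    have s2 := hcomp.contDiffAt_nat hq n
    rw [← norm_iteratedFDeriv_fderiv, (hf.iteratedFDeriv ℝ n).eq_of_nhds,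
      iteratedFDeriv_add_apply (L₁.contDiff.contDiffAt.comp q.2 s1)
        (L₂.contDiff.contDiffAt.comp q.2 s2)]
    refine (norm_add_le _ _).trans (add_le_add ?_ ?_)
    · refine (L₁.norm_iteratedFDeriv_comp_left s1 le_rfl).trans ?_
      gcongr
      exact hC q hq
    · refine (L₂.norm_iteratedFDeriv_comp_left s2 le_rfl).trans ?_
      gcongr
      exact hD q hq

/-- The partial derivatives in the second variable of a family with bounded derivatives. -/
theorem exists_bound_snd {A X Y G : Type*} [NormedAddCommGroup X] [NormedSpace ℝ X]
    [NormedAddCommGroup Y] [NormedSpace ℝ Y] [NormedAddCommGroup G] [NormedSpace ℝ G]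
    {g : A → X × Y → G} {S : Set (A × (X × Y))} (hg : SmoothBdd g S) {R : ℝ}
    (hR : ∀ q ∈ S, ‖q.2‖ ≤ R) (n : ℕ) :
    ∃ C, ∀ q ∈ S, ‖iteratedFDeriv ℝ n (fun y => g q.1 (q.2.1, y)) q.2.2‖ ≤ C := by
  let T : Set ((A × X) × Y) := {q | (q.1.1, (q.1.2, q.2)) ∈ S}
  have h1 : SmoothBdd (fun (p : A × X) (y : Y) => (p.2, y)) T :=
    (const (c := fun p : A × X => p.2) (C := R) fun q hq =>
      (norm_fst_le (q.1.2, q.2)).trans (hR _ hq)).prodMk (clm_of_le (.id ℝ Y) (R := R) fun q hq =>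
      (norm_snd_le (q.1.2, q.2)).trans (hR _ hq))
  have h2 : SmoothBdd (fun (p : A × X) => g p.1) {q : (A × X) × (X × Y) | (q.1.1, q.2) ∈ S} :=
    hg.reindex (fun _ hq => hq) fun _ _ => EventuallyEq.rfl
  obtain ⟨C, hC⟩ := (h2.comp h1 fun q hq => hq).bdd n
  exact ⟨C, fun q hq => hC ((q.1, q.2.1), q.2.2) hq⟩

end SmoothBdd

/-! ### Functions of a parameter and a variable -/

theorem eventually_norm_sub_le_of_isCompact {P E F : Type*}
    [NormedAddCommGroup P] [NormedAddCommGroup E] [NormedAddCommGroup F] {G : P × E → F} {U : Set P} (hU : IsOpen U)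
    (hG : ContinuousOn G (U ×ˢ univ)) {K : Set E} (hK : IsCompact K) {p : P} (hp : p ∈ U)
    {ε : ℝ} (hε : 0 < ε) :
    ∀ᶠ q in 𝓝 p, ∀ ξ ∈ K, ‖G (q, ξ) - G (p, ξ)‖ ≤ ε := by
  refine hK.eventually_forall_of_forall_eventually
    (P := fun q ξ => ‖G (q, ξ) - G (p, ξ)‖ ≤ ε) fun ξ _ => ?_
  have hc : ∀ q ∈ U, ∀ η, ContinuousAt G (q, η) := fun q hq η =>
    hG.continuousAt ((hU.prod isOpen_univ).mem_nhds ⟨hq, trivial⟩)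
  have h1 : ContinuousAt (fun z : P × E => ‖G (z.1, z.2) - G (p, z.2)‖) (p, ξ) := by
    refine ((hc p hp ξ).sub ?_).norm
    exact ContinuousAt.comp (f := fun z : P × E => (p, z.2)) (x := (p, ξ)) (hc p hp ξ)
      (by fun_prop)
  have h2 := h1.tendsto
  simp only [sub_self, norm_zero] at h2
  filter_upwards [h2.eventually (gt_mem_nhds hε)] with z hz using hz.le

section ParamDeriv

variable {P E F : Type*} [NormedAddCommGroup P] [NormedSpace ℝ P]
  [NormedAddCommGroup E] [NormedSpace ℝ E] [NormedAddCommGroup F] [NormedSpace ℝ F]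

/-- The iterated derivative of `G : P × E → F` in the directions `(v, 0)`, `v ∈ l`. -/
noncomputable def iterParamDeriv (G : P × E → F) : List P → P × E → F
  | [] => G
  | v :: l => fun z => fderiv ℝ (iterParamDeriv G l) z (v, 0)

theorem contDiffOn_iterParamDeriv {G : P × E → F} {W : Set (P × E)} (hW : IsOpen W)
    (hG : ContDiffOn ℝ ∞ G W) (l : List P) : ContDiffOn ℝ ∞ (iterParamDeriv G l) W := by
  induction l with
  | nil => exact hG
  | cons v l ih => exact (ih.fderiv_of_isOpen hW (by simp)).clm_apply contDiffOn_const

theorem iterParamDeriv_eq_zero {G : P × E → F} {W : Set (P × E)} (hW : IsOpen W)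
    (hG : ∀ z ∈ W, G z = 0) (l : List P) : ∀ z ∈ W, iterParamDeriv G l z = 0 := by
  induction l with
  | nil => exact hG
  | cons v l ih =>
    intro z hz
    have : iterParamDeriv G l =ᶠ[𝓝 z] fun _ => 0 := by
      filter_upwards [hW.mem_nhds hz] with y hy using ih y hy
    simp [iterParamDeriv, this.fderiv_eq]

theorem hasFDerivAt_slice {G : P × E → F} {U : Set P} (hU : IsOpen U)
    (hG : ContDiffOn ℝ ∞ G (U ×ˢ univ)) {p : P} (hp : p ∈ U) (ξ : E) :
    HasFDerivAt (fun η => G (p, η)) ((fderiv ℝ G (p, ξ)).comp (.inr ℝ P E)) ξ :=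
  ((hG.contDiffAt ((hU.prod isOpen_univ).mem_nhds ⟨hp, trivial⟩)).differentiableAt
    (by simp)).hasFDerivAt.comp ξ (hasFDerivAt_prodMk_right p ξ)

theorem contDiff_slice {G : P × E → F} {U : Set P}
    (hG : ContDiffOn ℝ ∞ G (U ×ˢ univ)) {p : P} (hp : p ∈ U) :
    ContDiff ℝ ∞ fun η => G (p, η) :=
  contDiffOn_univ.1 (hG.comp (contDiff_prodMk_right p).contDiffOn fun _ _ => ⟨hp, trivial⟩)

theorem contDiffOn_fderiv_comp_inr {G : P × E → F} {U : Set P} (hU : IsOpen U)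
    (hG : ContDiffOn ℝ ∞ G (U ×ˢ univ)) :
    ContDiffOn ℝ ∞ (fun z => (fderiv ℝ G z).comp (.inr ℝ P E)) (U ×ˢ univ) :=
  (hG.fderiv_of_isOpen (hU.prod isOpen_univ) (by simp)).clm_comp contDiffOn_const

end ParamDeriv

section UniformQuotient

universe u v
variable {P : Type*} {E : Type u} {F : Type (max u v)} [NormedAddCommGroup P] [NormedSpace ℝ P]
  [NormedAddCommGroup E] [NormedSpace ℝ E] [NormedAddCommGroup F] [NormedSpace ℝ F]

theorem eventually_norm_iteratedFDeriv_slice_sub_le {U : Set P} (hU : IsOpen U) {K : Set E}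
    (hK : IsCompact K) {p : P} (hp : p ∈ U) {ε : ℝ} (hε : 0 < ε) (n : ℕ) {G : P × E → F}
    (hG : ContDiffOn ℝ ∞ G (U ×ˢ univ)) :
    ∀ᶠ q in 𝓝 p, ∀ ξ ∈ K, ‖iteratedFDeriv ℝ n (fun η => G (q, η) - G (p, η)) ξ‖ ≤ ε := by
  induction n generalizing F with
  | zero =>
    simpa using eventually_norm_sub_le_of_isCompact hU hG.continuousOn hK hp hε
  | succ n ih =>
    filter_upwards [ih (contDiffOn_fderiv_comp_inr hU hG), hU.mem_nhds hp] with q hq hqU ξ hξ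
    rw [← norm_iteratedFDeriv_fderiv]
    have : fderiv ℝ (fun η => G (q, η) - G (p, η)) = fun η =>
        (fderiv ℝ G (q, η)).comp (.inr ℝ P E) - (fderiv ℝ G (p, η)).comp (.inr ℝ P E) := by
      ext1 η
      exact ((hasFDerivAt_slice hU hG hqU η).sub (hasFDerivAt_slice hU hG hp η)).fderiv
    rw [this]
    exact hq ξ hξ

/-- The difference quotients of a smooth function in a parameter converge to the derivative, with
all derivatives in the other variable, uniformly on compact sets. Derivatives in `ξ` are taken
one at a time, and the second derivative is symmetric, so that only uniform convergence of
the difference quotients themselves has to be shown. -/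
theorem eventually_norm_iteratedFDeriv_slice_quotient_le {U : Set P} (hU : IsOpen U) {K : Set E}
    (hK : IsCompact K) {p : P} (hp : p ∈ U) (v : P) {ε : ℝ} (hε : 0 < ε) (n : ℕ)
    {G : P × E → F} (hG : ContDiffOn ℝ ∞ G (U ×ˢ univ)) :
    ∀ᶠ t : ℝ in 𝓝[≠] 0, ∀ ξ ∈ K, ‖iteratedFDeriv ℝ n (fun η =>
      t⁻¹ • (G (p + t • v, η) - G (p, η)) - fderiv ℝ G (p, η) (v, 0)) ξ‖ ≤ ε := by
  have hline : Tendsto (fun t : ℝ => p + t • v) (𝓝 0) (𝓝 p) := by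
    have : Continuous fun t : ℝ => p + t • v := by fun_prop
    simpa using this.tendsto 0
  have hW := hU.prod (isOpen_univ (X := E))
  induction n generalizing F with
  | zero =>
    have hG' : ContinuousOn (fun z => fderiv ℝ G z (v, 0)) (U ×ˢ univ) :=
      ((hG.fderiv_of_isOpen (m := 0) hW (by simp)).continuousOn).clm_apply continuousOn_const
    have hev := hline.eventually ((eventually_norm_sub_le_of_isCompact hU hG' hK hp hε).and
      (hU.mem_nhds hp))
    obtain ⟨r, hr, hball⟩ := Metric.eventually_nhds_iff_ball.1 hev
    filter_upwards [mem_nhdsWithin_of_mem_nhds (Metric.ball_mem_nhds 0 hr), self_mem_nhdsWithin]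
      with t ht ht0 ξ hξ
    have ht0' : t ≠ 0 := ht0
    have hsub : ∀ s ∈ uIcc 0 t, s ∈ Metric.ball (0 : ℝ) r := fun s hs =>
      (convex_ball 0 r).segment_subset (Metric.mem_ball_self hr) ht (by rwa [segment_eq_uIcc])
    have key := norm_line_increment_sub_le (g := G) (g' := fun z => fderiv ℝ G z (v, 0))
      (y := (p, ξ)) (v := (v, 0)) (τ := t) (ε := ε) (w := fderiv ℝ G (p, ξ) (v, 0))
      (fun s hs => by
        have hs' : (p, ξ) + s • (v, (0 : E)) ∈ U ×ˢ univ := by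
          have hs1 : p + s • v ∈ U := (hball s (hsub s hs)).2
          simpa using hs1
        exact ((hG.contDiffAt (hW.mem_nhds hs')).differentiableAt (by simp)).hasFDerivAt.hasLineDerivAt _)
      (fun s hs => by simpa using (hball s (hsub s hs)).1 ξ hξ)
    rw [norm_iteratedFDeriv_zero]
    have e : t⁻¹ • (G (p + t • v, ξ) - G (p, ξ)) - fderiv ℝ G (p, ξ) (v, 0) =
        t⁻¹ • (G ((p, ξ) + t • (v, 0)) - G (p, ξ) - t • fderiv ℝ G (p, ξ) (v, 0)) := by
      rw [smul_sub, smul_sub, smul_sub, inv_smul_smul₀ ht0']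
      simp
    rw [e, norm_smul, norm_inv, Real.norm_eq_abs, inv_mul_le_iff₀ (abs_pos.2 ht0'), mul_comm]
    exact key
  | succ n ih =>
    have hpU : ∀ᶠ t : ℝ in 𝓝[≠] 0, p + t • v ∈ U :=
      mem_nhdsWithin_of_mem_nhds (hline (hU.mem_nhds hp))
    filter_upwards [ih (contDiffOn_fderiv_comp_inr hU hG), hpU] with t ht htU ξ hξ
    rw [← norm_iteratedFDeriv_fderiv]
    have hG2 : ContDiffOn ℝ ∞ (fun z => fderiv ℝ G z (v, 0)) (U ×ˢ univ) :=
      (hG.fderiv_of_isOpen hW (by simp)).clm_apply contDiffOn_const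
    have : fderiv ℝ (fun η => t⁻¹ • (G (p + t • v, η) - G (p, η)) - fderiv ℝ G (p, η) (v, 0)) =
        fun η => t⁻¹ • ((fderiv ℝ G (p + t • v, η)).comp (.inr ℝ P E) -
          (fderiv ℝ G (p, η)).comp (.inr ℝ P E)) -
          fderiv ℝ (fun z => (fderiv ℝ G z).comp (.inr ℝ P E)) (p, η) (v, 0) := by
      ext1 η
      have hη : U ×ˢ (univ : Set E) ∈ 𝓝 (p, η) := hW.mem_nhds ⟨hp, trivial⟩
      have d2 : HasFDerivAt (fderiv ℝ G) (fderiv ℝ (fderiv ℝ G) (p, η)) (p, η) :=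
        (((hG.fderiv_of_isOpen (m := ∞) hW (by simp)).contDiffAt hη).differentiableAt
          (by simp)).hasFDerivAt
      have hsymm : IsSymmSndFDerivAt ℝ G (p, η) :=
        (hG.contDiffAt hη).isSymmSndFDerivAt
          (by rw [minSmoothness_of_isRCLikeNormedField]; exact WithTop.coe_le_coe.2 (le_top (a := (2 : ℕ∞))))
      refine ((((hasFDerivAt_slice hU hG htU η).sub (hasFDerivAt_slice hU hG hp η)).const_smul
        t⁻¹).sub (hasFDerivAt_slice hU hG2 hp η)).fderiv.trans ?_
      congr 1
      rw [(d2.clm_apply (hasFDerivAt_const (v, (0 : E)) (p, η))).fderiv,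
        (d2.clm_comp (hasFDerivAt_const (ContinuousLinearMap.inr ℝ P E) (p, η))).fderiv]
      ext w
      simpa using hsymm.eq _ _
    rw [this]
    exact ht ξ hξ

end UniformQuotient

/-! ### Smooth maps into the space of test functions -/

section BackwardTestFn

open TopologicalSpace Distributions

open Classical in
/-- The slice `G (p, ·)` as an element of `𝓓_K`, where this makes sense, and `0` elsewhere. -/
noncomputable def sliceSupportedIn {P E F : Type*} [NormedAddCommGroup E] [NormedSpace ℝ E]
    [NormedAddCommGroup F] [NormedSpace ℝ F] (K : Compacts E) (G : P × E → F) (p : P) :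
    𝓓_{K}(E, F) :=
  if h : ContDiff ℝ ∞ (fun ξ => G (p, ξ)) ∧ EqOn (fun ξ => G (p, ξ)) 0 (K : Set E)ᶜ then
    ⟨fun ξ => G (p, ξ), h.1, h.2⟩
  else 0

universe u v
variable {P : Type*} {E : Type u} {F : Type (max u v)} [NormedAddCommGroup P] [NormedSpace ℝ P]
  [NormedAddCommGroup E] [NormedSpace ℝ E] [NormedAddCommGroup F] [NormedSpace ℝ F]
  {K : Compacts E} {G : P × E → F} {U : Set P}

theorem coe_sliceSupportedIn (hG : ContDiffOn ℝ ∞ G (U ×ˢ univ))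
    (hK : ∀ p ∈ U, ∀ ξ ∉ K, G (p, ξ) = 0) {p : P} (hp : p ∈ U) :
    (sliceSupportedIn K G p : E → F) = fun ξ => G (p, ξ) := by
  rw [sliceSupportedIn, dif_pos ⟨contDiff_slice hG hp, fun ξ hξ => hK p hp ξ hξ⟩]
  rfl

theorem continuousOn_sliceSupportedIn (hU : IsOpen U) (hG : ContDiffOn ℝ ∞ G (U ×ˢ univ))
    (hK : ∀ p ∈ U, ∀ ξ ∉ K, G (p, ξ) = 0) : ContinuousOn (sliceSupportedIn K G) U := by
  intro p hp
  refine ContinuousAt.continuousWithinAt ?_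
  rw [ContinuousAt, (ContDiffMapSupportedIn.withSeminorms ℝ E F ⊤ K).tendsto_nhds]
  intro n ε hε
  filter_upwards [eventually_norm_iteratedFDeriv_slice_sub_le.{u, v} hU K.isCompact hp
    (half_pos hε) n hG, hU.mem_nhds hp] with q hq hqU
  refine lt_of_le_of_lt ?_ (half_lt_self hε)
  rw [ContDiffMapSupportedIn.seminorm_top_le_iff ℝ (half_pos hε).le]
  rw [FunLike.coe_sub, coe_sliceSupportedIn hG hK hp, coe_sliceSupportedIn hG hK hqU]
  exact hq

theorem tendsto_quotient_sliceSupportedIn (hU : IsOpen U) (hG : ContDiffOn ℝ ∞ G (U ×ˢ univ))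
    (hK : ∀ p ∈ U, ∀ ξ ∉ K, G (p, ξ) = 0)
    (hK' : ∀ p ∈ U, ∀ v, ∀ ξ ∉ K, fderiv ℝ G (p, ξ) (v, 0) = 0) {p : P} (hp : p ∈ U) (v : P) :
    Tendsto (fun t : ℝ => t⁻¹ • (sliceSupportedIn K G (p + t • v) - sliceSupportedIn K G p))
      (𝓝[≠] 0) (𝓝 (sliceSupportedIn K (fun z => fderiv ℝ G z (v, 0)) p)) := by
  rw [(ContDiffMapSupportedIn.withSeminorms ℝ E F ⊤ K).tendsto_nhds]
  intro n ε hε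
  have hpU : ∀ᶠ t : ℝ in 𝓝[≠] 0, p + t • v ∈ U := by
    have : Continuous fun t : ℝ => p + t • v := by fun_prop
    exact mem_nhdsWithin_of_mem_nhds (this.continuousAt.preimage_mem_nhds
      (hU.mem_nhds (by simpa using hp)))
  filter_upwards [eventually_norm_iteratedFDeriv_slice_quotient_le.{u, v} hU K.isCompact hp v
    (half_pos hε) n hG, hpU] with t ht htU
  refine lt_of_le_of_lt ?_ (half_lt_self hε)
  rw [ContDiffMapSupportedIn.seminorm_top_le_iff ℝ (half_pos hε).le]
  have hG2 : ContDiffOn ℝ ∞ (fun z => fderiv ℝ G z (v, 0)) (U ×ˢ univ) :=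
    (hG.fderiv_of_isOpen (hU.prod isOpen_univ) (by simp)).clm_apply contDiffOn_const
  rw [FunLike.coe_sub, FunLike.coe_smul, FunLike.coe_sub, coe_sliceSupportedIn hG hK hp,
    coe_sliceSupportedIn hG hK htU, coe_sliceSupportedIn hG2 (fun q hq => hK' q hq v) hp]
  exact ht

/-- A function which is smooth in a parameter and a variable, and which vanishes for the variable
outside a fixed compact set, is a smooth function of the parameter with values in the space of
test functions. -/
theorem isDerivFamily_sliceSupportedIn {Ω : Opens E} (hU : IsOpen U)
    (hG : ContDiffOn ℝ ∞ G (U ×ˢ univ)) (hK : ∀ p ∈ U, ∀ ξ ∉ K, G (p, ξ) = 0)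
    (hΩ : (K : Set E) ⊆ Ω) {f : P → TestFunction Ω F ⊤} (hf : ∀ p ∈ U, ∀ ξ, f p ξ = G (p, ξ)) :
    IsDerivFamily f U fun l p =>
      TestFunction.ofSupportedInCLM ℝ hΩ (sliceSupportedIn K (iterParamDeriv G l) p) := by
  have hGl := fun l => contDiffOn_iterParamDeriv (hU.prod isOpen_univ) hG l
  have hKl : ∀ l, ∀ p ∈ U, ∀ ξ ∉ K, iterParamDeriv G l (p, ξ) = 0 := fun l p hp ξ hξ =>
    iterParamDeriv_eq_zero (hU.prod K.isCompact.isClosed.isOpen_compl)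
      (fun z hz => hK z.1 hz.1 z.2 hz.2) l (p, ξ) ⟨hp, hξ⟩
  refine ⟨fun p hp => ?_, fun v l p hp => ?_, fun l => ?_⟩
  · ext ξ
    rw [hf p hp]
    exact congrFun (coe_sliceSupportedIn hG hK hp) ξ
  · have h1 := tendsto_quotient_sliceSupportedIn.{u, v} hU (hGl l) (hKl l)
      (fun q hq w => hKl (w :: l) q hq) hp v
    have h2 := ((TestFunction.ofSupportedInCLM ℝ hΩ).continuous.tendsto _).comp h1
    rw [HasDirDeriv]
    refine (h2.mono_left (nhdsWithin_mono 0 fun t ht => ht.1)).congr fun t => ?_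
    simp only [Function.comp_apply, map_smul, map_sub]
  · exact (TestFunction.ofSupportedInCLM ℝ hΩ).continuous.comp_continuousOn
      (continuousOn_sliceSupportedIn.{u, v} hU (hGl l) (hKl l))

end BackwardTestFn

/-! ### Bounded sets of test functions -/

section Bounded

open TopologicalSpace Distributions

/-- Only finitely many of the points `x n` lie in a given compact set. -/
theorem exists_norm_smul_eval_le {E F : Type*} [NormedAddCommGroup E] [NormedAddCommGroup F]
    [NormedSpace ℝ F] {x : ℕ → E} (hx : ∀ n : ℕ, (n : ℝ) < ‖x n‖) (c : ℕ → ℝ) (K : Compacts E) :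
    ∃ C, 0 ≤ C ∧ ∀ (f : E → F) (M : ℝ), EqOn f 0 (K : Set E)ᶜ → (∀ y, ‖f y‖ ≤ M) →
      ∀ n, ‖c n • f (x n)‖ ≤ C * M := by
  obtain ⟨R, hR⟩ := K.isCompact.isBounded.exists_norm_le
  obtain ⟨N, hN⟩ := exists_nat_gt R
  refine ⟨∑ n ∈ Finset.range N, |c n|, Finset.sum_nonneg fun _ _ => abs_nonneg _,
    fun f M hf hM n => ?_⟩
  have hM0 : 0 ≤ M := (norm_nonneg _).trans (hM 0)
  by_cases hn : n < N
  · rw [norm_smul, Real.norm_eq_abs]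
    gcongr
    · exact Finset.single_le_sum (f := fun n => |c n|) (fun _ _ => abs_nonneg _)
        (Finset.mem_range.2 hn)
    · exact hM _
  · have hnK : x n ∉ K := fun h => by
      have h1 := hR _ h
      have h2 : (N : ℝ) ≤ n := mod_cast not_lt.1 hn
      linarith [hx n]
    rw [hf hnK]
    simp only [Pi.zero_apply, smul_zero, norm_zero]
    positivity

variable {E F : Type*} [NormedAddCommGroup E] [NormedSpace ℝ E]
  [NormedAddCommGroup F] [NormedSpace ℝ F]

theorem isVonNBounded_image_of_iteratedFDeriv_le {ι : Type*} {K : Compacts E}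
    {f : ι → 𝓓_{K}(E, F)} {s : Set ι}
    (h : ∀ n, ∃ C, ∀ i ∈ s, ∀ ξ ∈ K, ‖iteratedFDeriv ℝ n (f i) ξ‖ ≤ C) :
    Bornology.IsVonNBounded ℝ (f '' s) := by
  rw [(ContDiffMapSupportedIn.withSeminorms ℝ E F ⊤ K).image_isVonNBounded_iff_seminorm_bounded]
  intro n
  obtain ⟨C, hC⟩ := h n
  refine ⟨|C| + 1, by positivity, fun i hi => ?_⟩
  refine lt_of_le_of_lt ?_ (lt_add_one |C|)
  rw [ContDiffMapSupportedIn.seminorm_top_le_iff ℝ (abs_nonneg C)]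
  exact fun ξ hξ => (hC i hi ξ hξ).trans (le_abs_self C)

variable {x : ℕ → E} (hx : ∀ n : ℕ, (n : ℝ) < ‖x n‖) (c : ℕ → ℝ)

/-- For a sequence of points `x n` which tends to infinity, the weighted evaluations
`f ↦ (c n • f (x n))ₙ` form a continuous linear map from test functions to bounded sequences,
whatever the weights `c n`. -/
noncomputable def weightedEvalCLM :
    TestFunction (⊤ : Opens E) F ⊤ →L[ℝ] BoundedContinuousFunction ℕ F :=
  TestFunction.limitCLM ℝ
    (fun f => BoundedContinuousFunction.ofNormedAddCommGroupDiscrete (fun n => c n • f (x n)) _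
      ((exists_norm_smul_eval_le hx c ⟨tsupport f, f.hasCompactSupport⟩).choose_spec.2 f _
        (fun _ hy => image_eq_zero_of_notMem_tsupport hy)
        (f : BoundedContinuousFunction E F).norm_coe_le_norm))
    (fun K _ => ContDiffMapSupportedIn.mkCLMtoNormedSpace ℝ
      (fun f => BoundedContinuousFunction.ofNormedAddCommGroupDiscrete (fun n => c n • f (x n)) _
        ((exists_norm_smul_eval_le hx c K).choose_spec.2 f _ f.zero_on_compl
          (fun _ => ContDiffMapSupportedIn.norm_apply_le_seminorm ℝ)))
      (fun f g => by ext n; simp)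
      (fun r f => by ext n; exact smul_comm (c n) r (f (x n)))
      ⟨{0}, (exists_norm_smul_eval_le (F := F) hx c K).choose,
        (exists_norm_smul_eval_le hx c K).choose_spec.1, fun f => by
          have hC := (exists_norm_smul_eval_le (F := F) hx c K).choose_spec
          rw [Finset.sup_singleton, BoundedContinuousFunction.norm_le
            (mul_nonneg hC.1 (apply_nonneg _ _))]
          exact hC.2 f _ f.zero_on_compl
            (fun _ => ContDiffMapSupportedIn.norm_apply_le_seminorm ℝ)⟩)
    (fun K _ f => by ext n; rfl)

/-- The functions of a bounded set of test functions vanish outside a common ball. Otherwise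
evaluations at points tending to infinity, with suitable weights, would be unbounded. -/
theorem exists_forall_eq_zero_of_isVonNBounded {B : Set (TestFunction (⊤ : Opens E) F ⊤)}
    (hB : Bornology.IsVonNBounded ℝ B) : ∃ R : ℝ, ∀ f ∈ B, ∀ y, R < ‖y‖ → f y = 0 := by
  by_contra! hcon
  choose f hfB x hx hfx using fun n : ℕ => hcon n
  have himg := hB.image (weightedEvalCLM (F := F) hx fun n => n / ‖f n (x n)‖)
  rw [NormedSpace.isVonNBounded_iff] at himg
  obtain ⟨M, hM⟩ := himg.exists_norm_le
  obtain ⟨n, hn⟩ := exists_nat_gt M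
  have h1 := hM _ (mem_image_of_mem _ (hfB n))
  have h2 := (BoundedContinuousFunction.norm_coe_le_norm
    (weightedEvalCLM (F := F) hx (fun n => n / ‖f n (x n)‖) (f n)) n).trans h1
  change ‖((n : ℝ) / ‖f n (x n)‖) • f n (x n)‖ ≤ M at h2
  rw [norm_smul, norm_div, norm_norm, div_mul_cancel₀ _ (norm_ne_zero_iff.2 (hfx n)),
    Real.norm_natCast] at h2
  linarith

/-- The iterated directional derivatives of test functions, as continuous linear maps. -/
noncomputable def iterLineDerivCLM :
    List E → TestFunction (⊤ : Opens E) F ⊤ →L[ℝ] TestFunction (⊤ : Opens E) F ⊤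
  | [] => .id ℝ _
  | w :: m => (TestFunction.lineDerivCLM ℝ w).comp (iterLineDerivCLM m)

theorem exists_norm_iterLineDerivCLM_le {B : Set (TestFunction (⊤ : Opens E) F ⊤)}
    (hB : Bornology.IsVonNBounded ℝ B) (m : List E) :
    ∃ C, ∀ f ∈ B, ∀ y, ‖iterLineDerivCLM m f y‖ ≤ C := by
  have himg := hB.image ((TestFunction.toBoundedContinuousFunctionCLM ℝ).comp
    (iterLineDerivCLM (F := F) m))
  rw [NormedSpace.isVonNBounded_iff] at himg
  obtain ⟨M, hM⟩ := himg.exists_norm_le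
  exact ⟨M, fun f hf y => (BoundedContinuousFunction.norm_coe_le_norm _ y).trans
    (hM _ (mem_image_of_mem _ hf))⟩

end Bounded

/-! ### Joint smoothness of maps into the space of test functions -/

section Evaluation

open TopologicalSpace

variable {P E F : Type*} [NormedAddCommGroup P] [NormedSpace ℝ P]
  [NormedAddCommGroup E] [NormedSpace ℝ E] [NormedAddCommGroup F] [NormedSpace ℝ F]

theorem IsDerivFamily.mono {P F : Type*} [AddCommGroup P] [Module ℝ P] [TopologicalSpace P]
    [AddCommGroup F] [Module ℝ F] [TopologicalSpace F] {f : P → F} {U V : Set P}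
    {d : List P → P → F}
    (h : IsDerivFamily f U d) (hV : V ⊆ U) : IsDerivFamily f V d where
  nil := h.nil.mono hV
  cons v l p hp := (h.cons v l p (hV hp)).mono_left
    (nhdsWithin_mono 0 fun _ ht => ⟨ht.1, hV ht.2⟩)
  cont l := (h.cont l).mono hV

variable {f : P → TestFunction (⊤ : Opens E) F ⊤} {U : Set P}
  {d : List P → P → TestFunction (⊤ : Opens E) F ⊤}

namespace IsDerivFamily

theorem continuousOn_eval (h : IsDerivFamily f U d) (l : List P) (m : List E) :
    ContinuousOn (fun z : P × E => iterLineDerivCLM m (d l z.1) z.2) (U ×ˢ univ) :=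
  ContinuousOn.eval ((iterLineDerivCLM m).continuous.comp_continuousOn
    ((h.cont l).comp continuousOn_fst fun _ hz => hz.1)) continuousOn_snd

theorem hasLineDerivAt_eval_fst (h : IsDerivFamily f U d) (hU : IsOpen U) (l : List P)
    (m : List E) (v : P) {z : P × E} (hz : z.1 ∈ U) :
    HasLineDerivAt ℝ (fun z : P × E => iterLineDerivCLM m (d l z.1) z.2)
      (iterLineDerivCLM m (d (v :: l) z.1) z.2) z (v, 0) := by
  rw [hasLineDerivAt_iff_tendsto_slope_zero]
  have h1 : Tendsto (fun t : ℝ => t⁻¹ • (d l (z.1 + t • v) - d l z.1)) (𝓝[≠] 0)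
      (𝓝 (d (v :: l) z.1)) := by
    refine Tendsto.mono_left (h.cons v l z.1 hz) ?_
    have hc : Continuous fun t : ℝ => z.1 + t • v := by fun_prop
    refine nhdsWithin_le_iff.2 ?_
    filter_upwards [self_mem_nhdsWithin, mem_nhdsWithin_of_mem_nhds
      (hc.continuousAt.preimage_mem_nhds (hU.mem_nhds (by simpa using hz)))] with t h1 h2
    exact ⟨h1, h2⟩
  have hcont : Continuous fun g : TestFunction (⊤ : Opens E) F ⊤ => iterLineDerivCLM m g z.2 :=
    Continuous.eval (iterLineDerivCLM m).continuous continuous_const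
  refine ((hcont.tendsto _).comp h1).congr fun t => ?_
  simp

theorem hasLineDerivAt_eval_snd (d : List P → P → TestFunction (⊤ : Opens E) F ⊤) (l : List P)
    (m : List E) (w : E) (z : P × E) :
    HasLineDerivAt ℝ (fun z : P × E => iterLineDerivCLM m (d l z.1) z.2)
      (iterLineDerivCLM (w :: m) (d l z.1) z.2) z (0, w) := by
  have h1 := ((iterLineDerivCLM m (d l z.1)).contDiff.differentiable (by simp)
    z.2).hasFDerivAt.hasLineDerivAt w
  have e : iterLineDerivCLM (w :: m) (d l z.1) z.2 =
      fderiv ℝ (iterLineDerivCLM m (d l z.1)) z.2 w := by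
    change TestFunction.lineDerivCLM ℝ w (iterLineDerivCLM m (d l z.1)) z.2 = _
    rw [TestFunction.lineDerivCLM_apply_of_le le_top, h1.lineDeriv]
  rw [e]
  simpa [HasLineDerivAt] using h1

/-- A smooth map into the space of test functions is a smooth function of the parameter and the
variable. -/
theorem contDiffOn_eval [FiniteDimensional ℝ P] [FiniteDimensional ℝ E]
    (h : IsDerivFamily f U d) (hU : IsOpen U) :
    ContDiffOn ℝ ∞ (fun z : P × E => f z.1 z.2) (U ×ˢ univ) := by
  let bP := Module.finBasis ℝ P
  let bE := Module.finBasis ℝ E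
  refine (contDiffOn_of_basis_family (bP.prod bE) (hU.prod isOpen_univ)
    (fun (j : List P × List E) (z : P × E) => iterLineDerivCLM j.2 (d j.1 z.1) z.2)
    (Sum.elim (fun k j => (bP k :: j.1, j.2)) fun k j => (j.1, bE k :: j.2)) ?_
    (fun j => h.continuousOn_eval j.1 j.2) ([], [])).congr fun z hz => ?_
  · rintro (k | k) j z hz
    · simpa [Module.Basis.prod_apply] using h.hasLineDerivAt_eval_fst hU j.1 j.2 (bP k) hz.1
    · simpa [Module.Basis.prod_apply] using hasLineDerivAt_eval_snd d j.1 j.2 (bE k) z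
  · rw [← h.nil hz.1]; rfl

end IsDerivFamily

end Evaluation

/-! ### Smooth bounded paths -/

section Path

variable {s : ℕ} {𝕜 : Type*} [RCLike 𝕜] {Ω : Set (Euc s)} {φ : ℝ × Euc s → TestFn s 𝕜}

theorem IsSmoothBoundedPath.contDiffOn_eval (hφ : IsSmoothBoundedPath Ω φ) (hΩ : IsOpen Ω) :
    ContDiffOn ℝ ∞ (fun z : (ℝ × Euc s) × Euc s => φ z.1 z.2) ((Ioo 0 1 ×ˢ Ω) ×ˢ univ) := by
  obtain ⟨d, hd, -⟩ := hφ.smooth_bounded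
  exact (hd.mono (V := Ioo 0 1 ×ˢ Ω) (prod_mono_left Ioo_subset_Ioc_self)).contDiffOn_eval (isOpen_Ioo.prod hΩ)

theorem IsSmoothBoundedPath.exists_support_bound (hφ : IsSmoothBoundedPath Ω φ)
    {K : Set (Euc s)} (hK : IsCompact K) (hKΩ : K ⊆ Ω) :
    ∃ R : ℝ, 0 < R ∧ ∀ ε ∈ Ioc (0 : ℝ) 1, ∀ x ∈ K, ∀ η, R < ‖η‖ → φ (ε, x) η = 0 := by
  obtain ⟨d, hd, hb⟩ := hφ.smooth_bounded
  obtain ⟨R, hR⟩ := exists_forall_eq_zero_of_isVonNBounded (hb K hK hKΩ [])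
  refine ⟨max R 1, by positivity, fun ε hε x hx η hη => ?_⟩
  rw [← hd.nil ⟨hε, hKΩ hx⟩]
  exact hR _ (mem_image_of_mem _ ⟨hε, hx⟩) η ((le_max_left _ _).trans_lt hη)

/-- Only the derivatives in `x` are assumed to be bounded in the space of test functions; as
`x`-derivatives and `ξ`-derivatives together exhaust the partial derivatives for fixed `ε`, all
derivatives in `(x, ξ)` are bounded. -/
theorem IsSmoothBoundedPath.smoothBdd_eval (hφ : IsSmoothBoundedPath Ω φ) (hΩ : IsOpen Ω)
    {K : Set (Euc s)} (hK : IsCompact K) (hKΩ : K ⊆ Ω) :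
    SmoothBdd (fun (ε : ℝ) (z : Euc s × Euc s) => φ (ε, z.1) z.2)
      {q | q.1 ∈ Ioo 0 1 ∧ q.2.1 ∈ K} := by
  obtain ⟨d, hd', hb⟩ := hφ.smooth_bounded
  have hd := hd'.mono (V := Ioo 0 1 ×ˢ Ω) (prod_mono_left Ioo_subset_Ioc_self)
  have hU : IsOpen (Ioo (0 : ℝ) 1 ×ˢ Ω) := isOpen_Ioo.prod hΩ
  let b := (EuclideanSpace.basisFun (Fin s) ℝ).toBasis
  let W : ℝ → Set (Euc s × Euc s) := fun ε => {z | ε ∈ Ioo 0 1 ∧ z.1 ∈ Ω}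
  have hW : ∀ ε, IsOpen (W ε) := fun ε => (isOpen_const (X := Euc s × Euc s)).inter
    (hΩ.preimage continuous_fst)
  have key := SmoothBdd.of_basis_family (A := ℝ) (S := {q | q.1 ∈ Ioo (0 : ℝ) 1 ∧ q.2.1 ∈ K})
    (b.prod b)
    (fun (j : List (Fin s) × List (Euc s)) (ε : ℝ) (z : Euc s × Euc s) =>
      iterLineDerivCLM j.2 (d (xDirs j.1) (ε, z.1)) z.2)
    (Sum.elim (fun k j => (k :: j.1, j.2)) fun k j => (j.1, b k :: j.2)) hW
    (fun q hq => ⟨hq.1, hKΩ hq.2⟩) ?_ ?_ ?_ ([], [])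
  · refine key.reindex (σ := id) (fun _ hq => hq) fun q hq => ?_
    filter_upwards [(hW q.1).mem_nhds ⟨hq.1, hKΩ hq.2⟩] with z hz
    change φ (q.1, z.1) z.2 = d [] (q.1, z.1) z.2
    rw [hd.nil (show (q.1, z.1) ∈ Ioo (0 : ℝ) 1 ×ˢ Ω from hz)]
  · rintro (k | k) j ε z hz
    · have h1 := hd.hasLineDerivAt_eval_fst hU (xDirs j.1) j.2 (0, EuclideanSpace.single k 1)
        (z := ((ε, z.1), z.2)) hz
      simpa [HasLineDerivAt, Module.Basis.prod_apply, b, xDirs] using h1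
    · have h1 := IsDerivFamily.hasLineDerivAt_eval_snd d (xDirs j.1) j.2 (b k) ((ε, z.1), z.2)
      simpa [HasLineDerivAt, Module.Basis.prod_apply] using h1
  · intro j ε
    exact (hd.continuousOn_eval (xDirs j.1) j.2).comp
      (f := fun z : Euc s × Euc s => ((ε, z.1), z.2)) (by fun_prop) fun z hz => ⟨hz, trivial⟩
  · intro j
    obtain ⟨C, hC⟩ := exists_norm_iterLineDerivCLM_le (hb K hK hKΩ j.1) j.2
    exact ⟨C, fun q hq => hC _ (mem_image_of_mem _ ⟨Ioo_subset_Ioc_self hq.1, hq.2⟩) _⟩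

end Path

/-! ### The Jacobian determinant -/

section Determinant

variable {E : Type*} [NormedAddCommGroup E] [NormedSpace ℝ E]

theorem ContinuousLinearMap.contDiff_det [FiniteDimensional ℝ E] : ContDiff ℝ ∞ fun A : E →L[ℝ] E => A.det := by
  let b := Module.finBasis ℝ E
  have h : (fun A : E →L[ℝ] E => A.det) = fun A => ∑ σ : Equiv.Perm (Fin (Module.finrank ℝ E)),
      (Equiv.Perm.sign σ : ℝ) * ∏ i, (b.coord (σ i)).toContinuousLinearMap (A (b i)) := by
    ext A
    rw [ContinuousLinearMap.det, ← LinearMap.det_toMatrix b, Matrix.det_apply']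
    simp [LinearMap.toMatrix_apply]
  rw [h]
  refine ContDiff.sum fun σ _ => contDiff_const.mul (contDiff_prod fun i _ => ?_)
  exact (ContinuousLinearMap.contDiff _).comp (contDiff_id.clm_apply contDiff_const)

theorem OpenPartialHomeomorph.det_fderiv_symm_ne_zero (μ : OpenPartialHomeomorph E E)
    (hμ : DifferentiableOn ℝ μ μ.source) (hμ' : DifferentiableOn ℝ μ.symm μ.target) {y : E}
    (hy : y ∈ μ.target) : (fderiv ℝ μ.symm y).det ≠ 0 := by
  have hy' : μ.symm y ∈ μ.source := μ.map_target hy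
  have d1 := (hμ.differentiableAt (μ.open_source.mem_nhds hy')).hasFDerivAt
  have d2 := (hμ'.differentiableAt (μ.open_target.mem_nhds hy)).hasFDerivAt
  have d3 := d1.comp y d2
  have d4 : HasFDerivAt (μ ∘ μ.symm) (ContinuousLinearMap.id ℝ E) y := by
    refine (hasFDerivAt_id y).congr_of_eventuallyEq ?_
    filter_upwards [μ.open_target.mem_nhds hy] with z hz using μ.right_inv hz
  have h := congrArg ContinuousLinearMap.det (d3.unique d4)
  intro h0
  have h1 : ((fderiv ℝ μ (μ.symm y)).comp (fderiv ℝ μ.symm y)).det =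
      (fderiv ℝ μ (μ.symm y)).det * (fderiv ℝ μ.symm y).det := LinearMap.det_comp _ _
  have h2 : (ContinuousLinearMap.id ℝ E).det = 1 := LinearMap.det_id
  rw [h1, h0, mul_zero, h2] at h
  exact zero_ne_one h

theorem OpenPartialHomeomorph.contDiffOn_abs_det_fderiv_symm [FiniteDimensional ℝ E]
    (μ : OpenPartialHomeomorph E E)
    (hμ : DifferentiableOn ℝ μ μ.source) (hμ' : ContDiffOn ℝ ∞ μ.symm μ.target) :
    ContDiffOn ℝ ∞ (fun y => |(fderiv ℝ μ.symm y).det|) μ.target := by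
  intro y hy
  have h1 : ContDiffAt ℝ ∞ (fun y => (fderiv ℝ μ.symm y).det) y :=
    ContinuousLinearMap.contDiff_det.contDiffAt.comp y
      ((hμ'.fderiv_of_isOpen μ.open_target (by simp)).contDiffAt (μ.open_target.mem_nhds hy))
  exact ((contDiffAt_abs (μ.det_fderiv_symm_ne_zero hμ (hμ'.differentiableOn (by simp)) hy)).comp
    y h1).contDiffWithinAt

end Determinant

/-! ### The transformed test function -/

section Transform

variable {s : ℕ} {𝕜 : Type*} [RCLike 𝕜]

theorem isCompact_tsupport_scaling {ε : ℝ} (hε : ε ≠ 0) (ψ : TestFn s 𝕜) :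
    IsCompact (tsupport (scaling ε ψ)) := by
  have h : HasCompactSupport fun y => ψ ((1 / ε) • y) :=
    ψ.hasCompactSupport.comp_smul (one_div_ne_zero hε)
  exact h.smul_left (f := fun _ => (1 / ε) ^ s)

theorem smul_mem_tsupport_scaling {ε : ℝ} (hε : ε ≠ 0) {ψ : Euc s → 𝕜} {η : Euc s}
    (hη : ψ η ≠ 0) : ε • η ∈ tsupport (scaling ε ψ) := by
  refine subset_tsupport _ ?_
  rw [Function.mem_support, scaling, smul_smul, one_div_mul_cancel hε, one_smul]
  exact smul_ne_zero (pow_ne_zero _ (one_div_ne_zero hε)) hη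

variable {μ : OpenPartialHomeomorph (Euc s) (Euc s)} {φt : ℝ × Euc s → TestFn s 𝕜}
  {ε : ℝ} {x : Euc s}

theorem exists_mem_tsupport_of_transFun_ne_zero (hε : ε ≠ 0) {ξ : Euc s}
    (hξ : transFun μ φt ε x ξ ≠ 0) :
    ∃ y ∈ tsupport (scaling ε (φt (ε, μ.symm x))), ε⁻¹ • (μ (y + μ.symm x) - x) = ξ := by
  have hmem : ε • ξ + x ∈ μ.target := by
    by_contra h
    exact hξ (if_neg h)
  rw [transFun, if_pos hmem] at hξ
  refine ⟨_, smul_mem_tsupport_scaling hε (right_ne_zero_of_smul hξ), ?_⟩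
  rw [smul_inv_smul₀ hε, sub_add_cancel, μ.right_inv hmem, add_sub_cancel_right,
    inv_smul_smul₀ hε]

/-- If the support of the scaled test function, moved to `μ.symm x`, lies in `μ.source`, then the
transformed function is smooth and compactly supported. -/
theorem contDiff_hasCompactSupport_transFun (hμ : ContDiffOn ℝ ∞ μ μ.source)
    (hμ' : ContDiffOn ℝ ∞ μ.symm μ.target) (hε : ε ≠ 0)
    (hT : tsupport (scaling ε (φt (ε, μ.symm x))) ⊆ {y | y + μ.symm x ∈ μ.source}) :
    ContDiff ℝ ∞ (transFun μ φt ε x) ∧ HasCompactSupport (transFun μ φt ε x) := by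
  set T := tsupport (scaling ε (φt (ε, μ.symm x)))
  set K : Set (Euc s) := (fun y => ε⁻¹ • (μ (y + μ.symm x) - x)) '' T
  have hKc : IsCompact K := by
    refine (isCompact_tsupport_scaling hε _).image_of_continuousOn ?_
    have h1 : ContinuousOn (fun y => μ (y + μ.symm x)) T :=
      hμ.continuousOn.comp (by fun_prop) hT
    exact (h1.sub continuousOn_const).const_smul ε⁻¹
  have hzero : ∀ ξ ∉ K, transFun μ φt ε x ξ = 0 := by
    intro ξ hξ
    by_contra h
    exact hξ (exists_mem_tsupport_of_transFun_ne_zero hε h)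
  refine ⟨contDiff_iff_contDiffAt.2 fun ξ => ?_, HasCompactSupport.intro hKc hzero⟩
  -- The formula is smooth near `K`, and off the closed set `K` the function vanishes.
  by_cases hξ : ξ ∈ K
  · have hmem : ε • ξ + x ∈ μ.target := by
      obtain ⟨y, hy, rfl⟩ := hξ
      rw [smul_inv_smul₀ hε, sub_add_cancel]
      exact μ.map_source (hT hy)
    have hlin : ContDiff ℝ ∞ fun ξ : Euc s => ε • ξ + x :=
      (contDiff_id.const_smul ε).add contDiff_const
    have hnhds := μ.open_target.mem_nhds hmem
    have h1 : ContDiffAt ℝ ∞ (fun ξ => |(fderiv ℝ μ.symm (ε • ξ + x)).det|) ξ :=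
      ((μ.contDiffOn_abs_det_fderiv_symm (hμ.differentiableOn (by simp)) hμ').contDiffAt
        hnhds).comp (g := fun y => |(fderiv ℝ μ.symm y).det|) ξ hlin.contDiffAt
    have h2 : ContDiffAt ℝ ∞ (fun ξ => ε⁻¹ • (μ.symm (ε • ξ + x) - μ.symm x)) ξ :=
      (((hμ'.contDiffAt hnhds).comp ξ hlin.contDiffAt).sub contDiffAt_const).const_smul ε⁻¹
    refine (h1.smul ((φt (ε, μ.symm x)).contDiff.contDiffAt.comp ξ h2)).congr_of_eventuallyEq ?_
    filter_upwards [hlin.continuous.continuousAt.preimage_mem_nhds hnhds] with η hη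
    exact if_pos hη
  · refine (contDiffAt_const (c := (0 : 𝕜))).congr_of_eventuallyEq ?_
    filter_upwards [hKc.isClosed.isOpen_compl.mem_nhds hξ] with η hη using hzero η hη

/-- The change of variables formula: the transformed function has the same integral. -/
theorem integral_transFun (hμ' : ContDiffOn ℝ ∞ μ.symm μ.target) (hε : ε ≠ 0)
    (hT : tsupport (scaling ε (φt (ε, μ.symm x))) ⊆ {y | y + μ.symm x ∈ μ.source}) :
    ∫ ξ, transFun μ φt ε x ξ = ∫ η, φt (ε, μ.symm x) η := by
  set Ω' : Set (Euc s) := {ξ | ε • ξ + x ∈ μ.target}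
  set g : Euc s → Euc s := fun ξ => ε⁻¹ • (μ.symm (ε • ξ + x) - μ.symm x) with hg
  have hmeas : MeasurableSet Ω' :=
    (μ.open_target.preimage (f := fun ξ : Euc s => ε • ξ + x) (by fun_prop)).measurableSet
  have hderiv : ∀ ξ ∈ Ω', HasFDerivWithinAt g (fderiv ℝ μ.symm (ε • ξ + x)) Ω' ξ := by
    intro ξ hξ
    have d1 := ((hμ'.contDiffAt (μ.open_target.mem_nhds hξ)).differentiableAt
      (by simp)).hasFDerivAt
    have d2 : HasFDerivAt (fun ξ : Euc s => ε • ξ + x) (ε • ContinuousLinearMap.id ℝ (Euc s)) ξ :=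
      ((hasFDerivAt_id ξ).const_smul ε).add_const x
    have d3 := ((d1.comp ξ d2).sub_const (μ.symm x)).const_smul ε⁻¹
    refine HasFDerivAt.hasFDerivWithinAt (d3.congr_fderiv ?_)
    ext1 v
    simp [hε]
  have hinj : InjOn g Ω' := by
    intro ξ hξ η hη h
    have h1 := μ.symm.injOn hξ hη (sub_left_injective (smul_right_injective _ (inv_ne_zero hε) h))
    exact smul_right_injective _ hε (add_left_injective x h1)
  have h1 : ∫ ξ, transFun μ φt ε x ξ = ∫ ξ in Ω', transFun μ φt ε x ξ :=
    (setIntegral_eq_integral_of_forall_compl_eq_zero fun ξ hξ => if_neg hξ).symm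
  have h2 : ∫ ξ in Ω', transFun μ φt ε x ξ =
      ∫ ξ in Ω', |(fderiv ℝ μ.symm (ε • ξ + x)).det| • φt (ε, μ.symm x) (g ξ) :=
    setIntegral_congr_fun hmeas fun ξ hξ => if_pos hξ
  rw [h1, h2, ← integral_image_eq_integral_abs_det_fderiv_smul volume hmeas hderiv hinj]
  refine setIntegral_eq_integral_of_forall_compl_eq_zero fun η hη => ?_
  by_contra h
  have hsrc : ε • η + μ.symm x ∈ μ.source := hT (smul_mem_tsupport_scaling hε h)
  refine hη ⟨ε⁻¹ • (μ (ε • η + μ.symm x) - x), ?_, ?_⟩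
  · change ε • ε⁻¹ • (μ (ε • η + μ.symm x) - x) + x ∈ μ.target
    rw [smul_inv_smul₀ hε, sub_add_cancel]
    exact μ.map_source hsrc
  · rw [hg]
    simp only
    rw [smul_inv_smul₀ hε, sub_add_cancel, μ.left_inv hsrc, add_sub_cancel_right,
      inv_smul_smul₀ hε]

theorem exists_mem_A0_eq_transFun (hμ : ContDiffOn ℝ ∞ μ μ.source)
    (hμ' : ContDiffOn ℝ ∞ μ.symm μ.target) (hp : (ε, x) ∈ transDomain μ φt) :
    ∃ ψ ∈ A0 s 𝕜, ∀ ξ, ψ ξ = transFun μ φt ε x ξ := by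
  obtain ⟨⟨hε, -⟩, hA, -, hT⟩ := hp
  have hε' : ε ≠ 0 := hε.1.ne'
  have h := contDiff_hasCompactSupport_transFun hμ hμ' hε' hT
  refine ⟨⟨transFun μ φt ε x, h.1, h.2, fun _ _ => trivial⟩, ?_, fun _ => rfl⟩
  exact (integral_transFun hμ' hε' hT).trans hA

end Transform

/-! ### Smooth dependence and uniform bounds -/

section TransformBounds

variable {s : ℕ} {𝕜 : Type*} [RCLike 𝕜]
  {μ : OpenPartialHomeomorph (Euc s) (Euc s)} {φt : ℝ × Euc s → TestFn s 𝕜}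

theorem contDiffAt_transFun (hμ : ContDiffOn ℝ ∞ μ μ.source)
    (hμ' : ContDiffOn ℝ ∞ μ.symm μ.target) (hφt : IsSmoothBoundedPath μ.source φt)
    {z : (ℝ × Euc s) × Euc s} (hε : z.1.1 ∈ Ioo 0 1) (hx : z.1.2 ∈ μ.target)
    (hξ : z.1.1 • z.2 + z.1.2 ∈ μ.target) :
    ContDiffAt ℝ ∞ (fun z : (ℝ × Euc s) × Euc s => transFun μ φt z.1.1 z.1.2 z.2) z := by
  have hlin : ContDiff ℝ ∞ fun z : (ℝ × Euc s) × Euc s => z.1.1 • z.2 + z.1.2 := by fun_prop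
  have hnhds := μ.open_target.mem_nhds hξ
  have h1 : ContDiffAt ℝ ∞ (fun z : (ℝ × Euc s) × Euc s =>
      |(fderiv ℝ μ.symm (z.1.1 • z.2 + z.1.2)).det|) z :=
    ((μ.contDiffOn_abs_det_fderiv_symm (hμ.differentiableOn (by simp)) hμ').contDiffAt
      hnhds).comp (g := fun y => |(fderiv ℝ μ.symm y).det|) z hlin.contDiffAt
  have h2 : ContDiffAt ℝ ∞ (fun z : (ℝ × Euc s) × Euc s => μ.symm z.1.2) z :=
    (hμ'.contDiffAt (μ.open_target.mem_nhds hx)).comp z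
      (contDiff_snd.comp contDiff_fst).contDiffAt
  have h3 : ContDiffAt ℝ ∞ (fun z : (ℝ × Euc s) × Euc s =>
      μ.symm (z.1.1 • z.2 + z.1.2)) z := (hμ'.contDiffAt hnhds).comp z hlin.contDiffAt
  have h4 : ContDiffAt ℝ ∞ (fun z : (ℝ × Euc s) × Euc s => z.1.1) z :=
    (contDiff_fst.comp contDiff_fst).contDiffAt
  have h5 : ContDiffAt ℝ ∞ (fun z : (ℝ × Euc s) × Euc s => ((z.1.1, μ.symm z.1.2),
      z.1.1⁻¹ • (μ.symm (z.1.1 • z.2 + z.1.2) - μ.symm z.1.2))) z :=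
    (h4.prodMk h2).prodMk ((h4.inv hε.1.ne').smul (h3.sub h2))
  have h6 := ((hφt.contDiffOn_eval μ.open_source).contDiffAt
    (((isOpen_Ioo.prod μ.open_source).prod isOpen_univ).mem_nhds
      (show ((z.1.1, μ.symm z.1.2), z.1.1⁻¹ • (μ.symm (z.1.1 • z.2 + z.1.2) - μ.symm z.1.2)) ∈
        _ from ⟨⟨hε, μ.map_target hx⟩, trivial⟩))).comp z h5
  refine (h1.smul h6).congr_of_eventuallyEq ?_
  filter_upwards [hlin.continuous.continuousAt.preimage_mem_nhds hnhds] with y hy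
  exact if_pos hy

theorem smoothBdd_transFun (hμ : ContDiffOn ℝ ∞ μ μ.source)
    (hμ' : ContDiffOn ℝ ∞ μ.symm μ.target) (hφt : IsSmoothBoundedPath μ.source φt)
    {M N : Set (Euc s)} (hM : IsCompact M) (hMΩ : M ⊆ μ.target) (hN : IsCompact N)
    (hNΩ : N ⊆ μ.target) {R : ℝ} {S : Set (ℝ × (Euc s × Euc s))}
    (hε : ∀ q ∈ S, q.1 ∈ Ioo 0 1) (hx : ∀ q ∈ S, q.2.1 ∈ M) (hR : ∀ q ∈ S, ‖q.2.2‖ ≤ R)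
    (hseg : ∀ q ∈ S, segment ℝ q.2.1 (q.1 • q.2.2 + q.2.1) ⊆ N) :
    SmoothBdd (fun ε (z : Euc s × Euc s) => transFun μ φt ε z.1 z.2) S := by
  obtain ⟨B, hB⟩ := hM.isBounded.exists_norm_le
  have hz : ∀ q ∈ S, ‖q.2‖ ≤ max B R := fun q hq => max_le_max (hB _ (hx q hq)) (hR q hq)
  have hmem : ∀ q ∈ S, q.1 • q.2.2 + q.2.1 ∈ N := fun q hq => hseg q hq (right_mem_segment ..)
  have h1 : SmoothBdd (fun ε (z : Euc s × Euc s) =>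
      |(fderiv ℝ μ.symm (ε • z.2 + z.1)).det|) S :=
    (SmoothBdd.of_isCompact (S := univ ×ˢ N) μ.open_target
      (μ.contDiffOn_abs_det_fderiv_symm (hμ.differentiableOn (by simp)) hμ') hN hNΩ
      fun q hq => hq.2).comp (SmoothBdd.smul_snd_add_fst (fun q hq => by
        rw [Real.norm_of_nonneg (hε q hq).1.le]; exact (hε q hq).2.le) hz)
      fun q hq => ⟨trivial, hmem q hq⟩
  have h2 : SmoothBdd (fun (_ : ℝ) (z : Euc s × Euc s) => μ.symm z.1) S :=
    (SmoothBdd.of_isCompact (S := univ ×ˢ M) μ.open_target hμ' hM hMΩ fun q hq => hq.2).comp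
      (SmoothBdd.clm_of_le (.fst ℝ (Euc s) (Euc s)) hz) fun q hq => ⟨trivial, hx q hq⟩
  have h3 := SmoothBdd.diffQuot μ.open_target hμ' hN hNΩ
    (fun q hq => ⟨(hε q hq).1, (hε q hq).2.le⟩) hR hseg
  have h4 := (hφt.smoothBdd_eval μ.open_source (hM.image_of_continuousOn
    (hμ'.continuousOn.mono hMΩ)) (image_subset_iff.2 fun y hy => μ.map_target (hMΩ hy))).comp
      (h2.prodMk h3) fun q hq => ⟨hε q hq, mem_image_of_mem _ (hx q hq)⟩
  refine (h1.smul h4).reindex (σ := id) (fun _ hq => hq) fun q hq => ?_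
  have hlin : Continuous fun z : Euc s × Euc s => q.1 • z.2 + z.1 := by fun_prop
  filter_upwards [hlin.continuousAt.preimage_mem_nhds
    (μ.open_target.mem_nhds (hNΩ (hmem q hq)))] with y hy
  exact if_pos hy

theorem SmoothBdd.iterParamDeriv_xDirs {F : Type*} [NormedAddCommGroup F] [NormedSpace ℝ F]
    {G : (ℝ × Euc s) × Euc s → F} {U : Set (ℝ × Euc s)} (hU : IsOpen U)
    (hG : ContDiffOn ℝ ∞ G (U ×ˢ univ)) {S : Set (ℝ × (Euc s × Euc s))}
    (hS : ∀ q ∈ S, (q.1, q.2.1) ∈ U)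
    (h : SmoothBdd (fun ε (z : Euc s × Euc s) => G ((ε, z.1), z.2)) S) (β : List (Fin s)) :
    SmoothBdd (fun ε (z : Euc s × Euc s) => iterParamDeriv G (xDirs β) ((ε, z.1), z.2))
      S := by
  induction β with
  | nil => exact h
  | cons i β ih =>
    refine (ih.fderiv_apply (EuclideanSpace.single i 1, 0)).reindex (σ := id) (fun _ hq => hq)
      fun q hq => ?_
    have hc : Continuous fun z : Euc s × Euc s => (q.1, z.1) := by fun_prop
    filter_upwards [hc.continuousAt.preimage_mem_nhds (hU.mem_nhds (hS q hq))] with z hz'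
    have hz : (q.1, z.1) ∈ U := hz'
    have d1 : HasFDerivAt (iterParamDeriv G (xDirs β))
        (fderiv ℝ (iterParamDeriv G (xDirs β)) ((q.1, z.1), z.2)) ((q.1, z.1), z.2) :=
      (((contDiffOn_iterParamDeriv (hU.prod isOpen_univ) hG (xDirs β)).contDiffAt
        ((hU.prod isOpen_univ).mem_nhds ⟨hz, trivial⟩)).differentiableAt (by simp)).hasFDerivAt
    have d2 : HasFDerivAt (fun z : Euc s × Euc s => ((q.1, z.1), z.2))
        (((0 : Euc s × Euc s →L[ℝ] ℝ).prod (.fst ℝ _ _)).prod (.snd ℝ _ _)) z :=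
      ((hasFDerivAt_const q.1 z).prodMk hasFDerivAt_fst).prodMk hasFDerivAt_snd
    change _ = fderiv ℝ (iterParamDeriv G (xDirs β) ∘ fun z : Euc s × Euc s =>
      ((q.1, z.1), z.2)) z (EuclideanSpace.single i 1, 0)
    rw [(d1.comp z d2).fderiv]
    rfl

theorem norm_le_of_mem_tsupport_scaling {ε R : ℝ} (hε : 0 < ε) {ψ : Euc s → 𝕜}
    (hψ : ∀ η, R < ‖η‖ → ψ η = 0) {y : Euc s} (hy : y ∈ tsupport (scaling ε ψ)) :
    ‖y‖ ≤ ε * R := by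
  have hsub : tsupport (scaling ε ψ) ⊆ Metric.closedBall 0 (ε * R) := by
    refine closure_minimal (fun w hw => ?_) Metric.isClosed_closedBall
    have h1 : ψ ((1 / ε) • w) ≠ 0 := right_ne_zero_of_smul hw
    have h2 : ‖(1 / ε) • w‖ ≤ R := le_of_not_gt fun h => h1 (hψ _ h)
    rw [norm_smul, norm_div, norm_one, Real.norm_of_nonneg hε.le, one_div,
      inv_mul_le_iff₀ hε] at h2
    simpa using h2
  simpa using hsub hy

theorem segment_add_subset_cthickening {M : Set (Euc s)} {x y : Euc s} {δ : ℝ} (hx : x ∈ M)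
    (hy : ‖y‖ ≤ δ) : segment ℝ x (y + x) ⊆ Metric.cthickening δ M := by
  have hδ : 0 ≤ δ := (norm_nonneg y).trans hy
  have h1 : segment ℝ x (y + x) ⊆ Metric.closedBall x δ :=
    (convex_closedBall x δ).segment_subset (Metric.mem_closedBall_self hδ) (by simpa using hy)
  exact h1.trans (Metric.closedBall_subset_cthickening hx δ)

/-- For base points in a compact set and for small `ε`, the transformed functions are defined and
supported in a common ball, and `ε • ξ + x` stays in a compact subset of `μ.target` for `ξ` in a
larger ball. The radius comes from the mean value inequality for `μ`. -/
theorem exists_transFun_support_bound (hμ : ContDiffOn ℝ ∞ μ μ.source)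
    (hμ' : ContDiffOn ℝ ∞ μ.symm μ.target) (hφt : IsSmoothBoundedPath μ.source φt)
    {M : Set (Euc s)} (hM : IsCompact M) (hMΩ : M ⊆ μ.target) :
    ∃ ε₁ ∈ Ioc (0 : ℝ) 1, ∃ R : ℝ, ∃ N : Set (Euc s), IsCompact N ∧ N ⊆ μ.target ∧
      ∀ ε ∈ Ioo 0 ε₁, ∀ x ∈ M, (ε, x) ∈ transDomain μ φt ∧
        (∀ ξ, R < ‖ξ‖ → transFun μ φt ε x ξ = 0) ∧
        ∀ ξ, ‖ξ‖ ≤ R + 1 → segment ℝ x (ε • ξ + x) ⊆ N := by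
  set M' := μ.symm '' M
  have hM' : IsCompact M' := hM.image_of_continuousOn (hμ'.continuousOn.mono hMΩ)
  have hM'Ω : M' ⊆ μ.source := image_subset_iff.2 fun y hy => μ.map_target (hMΩ hy)
  obtain ⟨R, hR0, hR⟩ := hφt.exists_support_bound hM' hM'Ω
  obtain ⟨δ, hδ0, hδ⟩ := hM.exists_cthickening_subset_open μ.open_target hMΩ
  obtain ⟨δ', hδ'0, hδ'⟩ := hM'.exists_cthickening_subset_open μ.open_source hM'Ω
  have hcont : ContinuousOn (fderiv ℝ μ) (Metric.cthickening δ' M') :=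
    ((hμ.fderiv_of_isOpen (m := 0) μ.open_source (by simp)).continuousOn).mono hδ'
  obtain ⟨C, hC⟩ := hM'.cthickening.exists_bound_of_continuousOn hcont
  -- The value `R₁ + 1` leaves room for a neighbourhood of the ball of radius `R₁`.
  set R₁ := |C| * R
  have hR₁ : 0 < R₁ + 1 := by positivity
  refine ⟨min 1 (min (δ' / R) (δ / (R₁ + 1))), ⟨by positivity, min_le_left _ _⟩, R₁,
    Metric.cthickening δ M, hM.cthickening, hδ, fun ε hε x hx => ?_⟩
  have hε0 := hε.1
  have hε1 : ε < 1 := hε.2.trans_le (min_le_left _ _)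
  have hεR : ε * R ≤ δ' := by
    rw [← le_div_iff₀ hR0]
    exact hε.2.le.trans ((min_le_right _ _).trans (min_le_left _ _))
  have hεR₁ : ε * (R₁ + 1) ≤ δ := by
    rw [← le_div_iff₀ hR₁]
    exact hε.2.le.trans ((min_le_right _ _).trans (min_le_right _ _))
  have hx' : μ.symm x ∈ M' := mem_image_of_mem _ hx
  have hsupp := hR ε ⟨hε0, hε1.le⟩ _ hx'
  have hseg : ∀ y ∈ tsupport (scaling ε (φt (ε, μ.symm x))),
      segment ℝ (μ.symm x) (y + μ.symm x) ⊆ Metric.cthickening δ' M' := fun y hy =>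
    segment_add_subset_cthickening hx' ((norm_le_of_mem_tsupport_scaling hε0 hsupp hy).trans hεR)
  refine ⟨⟨⟨⟨hε0, hε1.le⟩, hMΩ hx⟩, hφt.mapsTo ⟨⟨hε0, hε1.le⟩, hM'Ω hx'⟩, hM'Ω hx',
    fun y hy => hδ' (hseg y hy (right_mem_segment ..))⟩, fun ξ hξ => ?_, fun ξ hξ => ?_⟩
  · by_contra h
    obtain ⟨y, hy, rfl⟩ := exists_mem_tsupport_of_transFun_ne_zero hε0.ne' h
    have mv := Convex.norm_image_sub_le_of_norm_fderiv_le (𝕜 := ℝ) (f := μ) (C := |C|)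
      (fun w hw => (hμ.contDiffAt (μ.open_source.mem_nhds
        (hδ' (hseg y hy hw)))).differentiableAt (by simp))
      (fun w hw => (hC w (hseg y hy hw)).trans (le_abs_self C))
      (convex_segment ..) (left_mem_segment ..) (right_mem_segment ..)
    rw [μ.right_inv (hMΩ hx), add_sub_cancel_right] at mv
    refine hξ.not_ge ?_
    rw [norm_smul, norm_inv, Real.norm_of_nonneg hε0.le, inv_mul_le_iff₀ hε0]
    calc _ ≤ |C| * ‖y‖ := mv
      _ ≤ |C| * (ε * R) := by
          gcongr; exact norm_le_of_mem_tsupport_scaling hε0 hsupp hy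
      _ = ε * R₁ := by ring
  · refine segment_add_subset_cthickening hx (le_trans ?_ hεR₁)
    rw [norm_smul, Real.norm_of_nonneg hε0.le]
    gcongr

end TransformBounds

theorem theorem3p3 {𝕜 : Type*} [RCLike 𝕜] (s : ℕ)
    (μ : OpenPartialHomeomorph (Euc s) (Euc s))
    (hμ : ContDiffOn ℝ ∞ μ μ.source) (hμ' : ContDiffOn ℝ ∞ μ.symm μ.target)
    (φt : ℝ × Euc s → TestFn s 𝕜) (hφt : IsSmoothBoundedPath μ.source φt) :
    ∃ φ : ℝ × Euc s → TestFn s 𝕜,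
      (∀ ε x, (ε, x) ∈ transDomain μ φt → ∀ ξ, φ (ε, x) ξ = transFun μ φt ε x ξ) ∧
      IsZTestObject μ.target (transDomain μ φt) φ := by
  classical
  have hex : ∀ p : ℝ × Euc s, ∃ ψ : TestFn s 𝕜, p ∈ transDomain μ φt →
      ψ ∈ A0 s 𝕜 ∧ ∀ ξ, ψ ξ = transFun μ φt p.1 p.2 ξ := by
    intro p
    by_cases hp : p ∈ transDomain μ φt
    · obtain ⟨ψ, h1, h2⟩ := exists_mem_A0_eq_transFun hμ hμ' hp
      exact ⟨ψ, fun _ => ⟨h1, h2⟩⟩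
    · exact ⟨0, fun h => absurd h hp⟩
  choose φ hφ using hex
  refine ⟨φ, fun ε x hp => (hφ _ hp).2, fun p hp => hp.1, fun p hp => (hφ p hp).1,
    fun L hL hLΩ => ?_⟩
  obtain ⟨V, hV, hLV, hVΩ, hVc⟩ := exists_open_between_and_isCompact_closure hL μ.open_target hLΩ
  obtain ⟨ε₁, hε₁, R, N, hN, hNΩ, hsmall⟩ :=
    exists_transFun_support_bound hμ hμ' hφt hVc hVΩ
  set U : Set (ℝ × Euc s) := Ioo 0 ε₁ ×ˢ V
  have hU : IsOpen U := isOpen_Ioo.prod hV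
  have hUD : U ⊆ transDomain μ φt := fun p hp => (hsmall p.1 hp.1 p.2 (subset_closure hp.2)).1
  have hLU : Ioc 0 (ε₁ / 2) ×ˢ L ⊆ U :=
    prod_mono (fun ε hε => ⟨hε.1, hε.2.trans_lt (half_lt_self hε₁.1)⟩) hLV
  set G : (ℝ × Euc s) × Euc s → 𝕜 := fun z => transFun μ φt z.1.1 z.1.2 z.2
  have hzero : ∀ p ∈ U, ∀ ξ, R < ‖ξ‖ → G (p, ξ) = 0 := fun p hp =>
    (hsmall p.1 hp.1 p.2 (subset_closure hp.2)).2.1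
  have hseg : ∀ p ∈ U, ∀ ξ, ‖ξ‖ ≤ R + 1 → segment ℝ p.2 (p.1 • ξ + p.2) ⊆ N := fun p hp =>
    (hsmall p.1 hp.1 p.2 (subset_closure hp.2)).2.2
  have hε1 : ∀ p ∈ U, p.1 ∈ Ioo (0 : ℝ) 1 := fun p hp => ⟨hp.1.1, hp.1.2.trans_le hε₁.2⟩
  have hG : ContDiffOn ℝ ∞ G (U ×ˢ univ) := by
    rintro ⟨p, ξ⟩ ⟨hp, -⟩
    refine ContDiffAt.contDiffWithinAt ?_
    -- Near `‖ξ‖ ≤ R` the formula applies; for `R < ‖ξ‖` the function vanishes identically.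
    rcases le_or_gt ‖ξ‖ R with hξ | hξ
    · exact contDiffAt_transFun hμ hμ' hφt (hε1 p hp) (hVΩ (subset_closure hp.2))
        (hNΩ (hseg p hp ξ (by linarith) (right_mem_segment ..)))
    · refine (contDiffAt_const (c := (0 : 𝕜))).congr_of_eventuallyEq ?_
      have hopen : IsOpen (U ×ˢ {ξ : Euc s | R < ‖ξ‖}) :=
        hU.prod (isOpen_lt continuous_const continuous_norm)
      filter_upwards [hopen.mem_nhds ⟨hp, hξ⟩] with z hz using hzero z.1 hz.1 z.2 hz.2
  let K : TopologicalSpace.Compacts (Euc s) :=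
    ⟨Metric.closedBall 0 (R + 1), isCompact_closedBall 0 (R + 1)⟩
  have hK : ∀ p ∈ U, ∀ ξ ∉ K, G (p, ξ) = 0 := by
    intro p hp ξ hξ
    refine hzero p hp ξ ?_
    have : R + 1 < ‖ξ‖ := by
      by_contra h
      exact hξ (mem_closedBall_zero_iff.2 (not_lt.1 h))
    linarith
  have hKtop : (K : Set (Euc s)) ⊆ ((⊤ : TopologicalSpace.Opens (Euc s)) : Set (Euc s)) :=
    fun _ _ => trivial
  have hd := isDerivFamily_sliceSupportedIn hU hG hK hKtop fun p hp => (hφ p (hUD hp)).2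
  refine ⟨ε₁ / 2, ⟨half_pos hε₁.1, by linarith [hε₁.2, hε₁.1]⟩, U, ⟨U, hU, ?_⟩, hLU, hUD, _,
    hd, fun β => ?_⟩
  · have hsub : U ⊆ Ioc 0 1 ×ˢ μ.target := fun p hp => (hUD hp).1
    exact (inter_eq_left.2 hsub).symm
  · suffices hb : Bornology.IsVonNBounded ℝ (sliceSupportedIn K
        (iterParamDeriv G (xDirs β)) '' (Ioc 0 (ε₁ / 2) ×ˢ L)) by
      have himg := hb.image (TestFunction.ofSupportedInCLM ℝ hKtop)
      rwa [image_image] at himg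
    refine isVonNBounded_image_of_iteratedFDeriv_le fun n => ?_
    let S : Set (ℝ × (Euc s × Euc s)) := {q | (q.1, q.2.1) ∈ U ∧ ‖q.2.2‖ ≤ R + 1}
    have hS := (smoothBdd_transFun (S := S) hμ hμ' hφt hVc hVΩ hN hNΩ
      (fun q hq => hε1 _ hq.1) (fun q hq => subset_closure hq.1.2) (fun q hq => hq.2)
      fun q hq => hseg _ hq.1 _ hq.2).iterParamDeriv_xDirs (G := G) hU hG (fun q hq => hq.1) β
    obtain ⟨B, hB⟩ := hVc.isBounded.exists_norm_le
    obtain ⟨C, hC⟩ := hS.exists_bound_snd (R := max B (R + 1)) (fun q hq =>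
      max_le_max (hB _ (subset_closure hq.1.2)) hq.2) n
    refine ⟨C, fun p hp ξ hξ => ?_⟩
    rw [coe_sliceSupportedIn (contDiffOn_iterParamDeriv (hU.prod isOpen_univ) hG _)
      (fun q hq η hη => iterParamDeriv_eq_zero (hU.prod K.isCompact.isClosed.isOpen_compl)
        (fun z hz => hK z.1 hz.1 z.2 hz.2) _ (q, η) ⟨hq, hη⟩) (hLU hp)]
    exact hC (p.1, (p.2, ξ)) ⟨hLU hp, mem_closedBall_zero_iff.1 hξ⟩
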